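/- Let $p$ be an odd prime and let $m,n$ be natural numbers with $2^m\mid p^n-1$ and $2^{m+1}\nmid p^n-1$. Put $d=(p^n-1)/2^m$ and let $C_{2^m}$ be the cyclic group of order $2^m$. Then there exists a generic $C_{2^m}$-extension over $\mathbb F_p$. Moreover, it is given by $\mathbb F_p[A,U^d]/\mathbb F_p[A]$, with the following notation. Let $e_1,\dots,e_n$ be any basis of $\mathbb F_{p^n}$ over $\mathbb F_p$, and for $z\in\mathbb F_{p^n}$ let $M_z\in M_n(\mathbb F_p)$ be the matrix of multiplication by $z$ in this basis. Let $T=\mathrm{Res}_{\mathbb F_{p^n}/\mathbb F_p}\mathbf G_m\subset\mathbf{GL}_n$ be the torus of invertible matrices of the form $\sum_k a_kM_{e_k}$, let $U=\sum_k x_kM_{e_k}$ be its general element, with entries in the rational function field $\mathbb F_p(x_1,\dots,x_n)$, and let $A=\lambda(U)=U\,(U^{(p)})^{-1}$, where $U^{(p)}$ is obtained from $U$ by raising every entry to the $p$-th power. $\mathbb F_p[A]$ is the $\mathbb F_p$-subalgebra of $\mathbb F_p(x_1,\dots,x_n)$ generated by the entries of $A$ and $1/\det A$, and $\mathbb F_p[A,U^d]$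 is the $\mathbb F_p[A]$-subalgebra generated by the entries of $U^d$ and $1/\det(U^d)$. The group $C_{2^m}$ acts on $\mathbb F_p[A,U^d]$ over $\mathbb F_p[A]$ through an embedding $\iota:C_{2^m}\hookrightarrow T(\mathbb F_p)\cong\mathbb F_{p^n}^{\ast}$, with $g$ acting by $U\mapsto U\,\iota(g)$, i.e. by $U^d\mapsto (U\,\iota(g))^d$. Here, for a finite group $G$, an extension $S/R$ of commutative rings with an action of $G$ on $S$ by $R$-algebra automorphisms is Galois with group $G$ if $S^G=R$ and for every maximal ideal $\mathfrak m$ of $S$ and every $g\neq 1$ in $G$ there is $s\in S$ with $gs-s\notin\mathfrak m$; when $R$ is a field, $S$ is called a Galois $G$-algebra over $R$. A Galois extension $S/R$ with group $G$, where $R$ is an algebra over a field $K$, is a generic $G$-extension over $K$ if (1) $R\cong K[t_1,\dots,t_k,1/g]$ as $K$-algebras for some $k$ and some nonzero polynomial $g$, and (2) for every extension field $L$ of $K$ and every Galois $G$-algebra $M$ over $L$ there is a $K$-algebra homomorphism $\varphi:R\to L$ such that $S\otimes_\varphi L$ and $M$ are isomorphic as $G$-algebras over $L$. -/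

import Mathlib

open scoped TensorProduct

universe u v w

/-- `S/R` is a Galois extension of commutative rings with group `G`: the finite group `G` acts on
the overring `S` of `R` by `R`-algebra automorphisms, `S ^ G = R`, and no nontrivial element of `G`
acts trivially modulo a maximal ideal of `S`. When `R` is a field this is a Galois `G`-algebra. -/
structure IsGaloisRingExtension (G R S : Type*) [Group G] [CommRing R] [CommRing S] [Algebra R S]
    [MulSemiringAction G S] : Prop where
  finite : Finite G
  injective : Function.Injective (algebraMap R S)
  smul_algebraMap : ∀ (g : G) (r : R), g • algebraMap R S r = algebraMap R S r
  exists_of_fixed : ∀ s : S, (∀ g : G, g • s = s) → ∃ r : R, algebraMap R S r = s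
  free : ∀ I : Ideal S, I.IsMaximal → ∀ g : G, g ≠ 1 → ∃ s : S, g • s - s ∉ I

/-- `R` is a localized polynomial ring `K[t₁, …, t_k, 1/g]` with `g ≠ 0`. -/
def IsLocalizedPolynomialRing (K R : Type*) [Field K] [CommRing R] [Algebra K R] : Prop :=
  ∃ (k : ℕ) (g : MvPolynomial (Fin k) K), g ≠ 0 ∧ Nonempty (R ≃ₐ[K] Localization.Away g)

/-- `L ⊗ S`, formed along `φ : R → L`, and `M` are isomorphic as `G`-algebras over `L`.
Here `G` acts on the tensor product through `S`; equivariance is stated on pure tensors. -/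
def SpecializesTo (G : Type*) {R : Type*} (S : Type*) {L : Type*} (M : Type*) [Group G]
    [CommRing R] [CommRing S] [Algebra R S] [MulSemiringAction G S]
    [Field L] [CommRing M] [Algebra L M] [MulSemiringAction G M] (φ : R →+* L) : Prop :=
  letI : Algebra R L := φ.toAlgebra
  ∃ e : (L ⊗[R] S) ≃ₐ[L] M,
    ∀ (g : G) (x : L) (s : S), e (x ⊗ₜ[R] (g • s)) = g • e (x ⊗ₜ[R] s)

/-- `S/R` (with the given action of `G` on `S`) is a generic `G`-extension over the field `K`. -/
structure IsGenericExtension (K G R S : Type*) [Field K] [Group G] [CommRing R] [CommRing S]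
    [Algebra K R] [Algebra R S] [MulSemiringAction G S] : Prop where
  galois : IsGaloisRingExtension G R S
  localizedPolynomial : IsLocalizedPolynomialRing K R
  generic : ∀ (L : Type u) [Field L] [Algebra K L] (M : Type v) [CommRing M] [Algebra L M]
    [MulSemiringAction G M], IsGaloisRingExtension G L M →
      ∃ φ : R →ₐ[K] L, SpecializesTo G S M (φ : R →+* L)

section Torus

variable {K E : Type*} [Field K] [Field E] [Algebra K E] {n : ℕ}

/-- The matrix `∑ₖ aₖ M_{eₖ}`, where `M_z` is the matrix of multiplication by `z ∈ E` in the
`K`-basis `e` of `E`; the coefficients `aₖ` lie in a commutative `K`-algebra `L`. -/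
noncomputable def resMatrix (e : Module.Basis (Fin n) K E) {L : Type*} [CommRing L] [Algebra K L]
    (a : Fin n → L) : Matrix (Fin n) (Fin n) L :=
  ∑ k, a k • (Algebra.leftMulMatrix e (e k)).map (algebraMap K L)

/-- The `L`-points of `T = Res_{E/K} G_m ⊆ GL_n`: the invertible matrices `∑ₖ aₖ M_{eₖ}`. -/
def resTorus (e : Module.Basis (Fin n) K E) (L : Type*) [CommRing L] [Algebra K L] :
    Set (GL (Fin n) L) :=
  {g | ∃ a : Fin n → L, (g : Matrix (Fin n) (Fin n) L) = resMatrix e a}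

/-- The function field `K(x₁, …, x_n)`. -/
def RatFuncs (K : Type*) [Field K] (n : ℕ) : Type _ := FractionRing (MvPolynomial (Fin n) K)

noncomputable instance : Field (RatFuncs K n) :=
  inferInstanceAs (Field (FractionRing (MvPolynomial (Fin n) K)))

noncomputable instance : Algebra (MvPolynomial (Fin n) K) (RatFuncs K n) :=
  inferInstanceAs (Algebra (MvPolynomial (Fin n) K) (FractionRing (MvPolynomial (Fin n) K)))

instance : IsFractionRing (MvPolynomial (Fin n) K) (RatFuncs K n) :=
  inferInstanceAs
    (IsFractionRing (MvPolynomial (Fin n) K) (FractionRing (MvPolynomial (Fin n) K)))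

noncomputable instance : Algebra K (RatFuncs K n) :=
  inferInstanceAs (Algebra K (FractionRing (MvPolynomial (Fin n) K)))

instance : IsScalarTower K (MvPolynomial (Fin n) K) (RatFuncs K n) :=
  inferInstanceAs
    (IsScalarTower K (MvPolynomial (Fin n) K) (FractionRing (MvPolynomial (Fin n) K)))

/-- The indeterminates `x₁, …, x_n` as elements of `K(x₁, …, x_n)`. -/
noncomputable def indet (K : Type*) [Field K] (n : ℕ) : Fin n → RatFuncs K n :=
  fun k => algebraMap (MvPolynomial (Fin n) K) (RatFuncs K n) (MvPolynomial.X k)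

end Torus

/-- The Lang–Steinberg map `X ↦ X (X^{(q)})⁻¹`, with `X^{(q)}` the entrywise `q`-th power. -/
noncomputable def langMap (q : ℕ) {n : ℕ} {L : Type*} [Field L] (X : Matrix (Fin n) (Fin n) L) :
    Matrix (Fin n) (Fin n) L :=
  X * (X.map (· ^ q))⁻¹

/-- `R[X]` for an invertible matrix `X` over a field `L ⊇ R`: the `R`-subalgebra of `L` generated
by the entries of `X` and by `1 / det X`. -/
def matrixAlgebra (R : Type*) {L : Type*} [CommRing R] [Field L] [Algebra R L] {n : ℕ}
    (X : Matrix (Fin n) (Fin n) L) : Subalgebra R L :=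
  Algebra.adjoin R (insert (X.det)⁻¹ {x | ∃ i j, x = X i j})

section Extension

variable {p : ℕ} [Fact p.Prime] {n : ℕ} {F : Type*} [Field F] [Algebra (ZMod p) F]
  {Ω : Type*} [Field Ω] [Algebra (ZMod p) Ω]

/-- The ring `F_p[A]`, where `A = λ(U)` and `U = ∑ₖ xₖ M_{eₖ}` for `x₁, …, x_n` in a field `Ω`.
When the `xₖ` are the indeterminates, `U` is the general element of `T`. -/
noncomputable def baseRing (e : Module.Basis (Fin n) (ZMod p) F) (x : Fin n → Ω) :
    Subalgebra (ZMod p) Ω :=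
  matrixAlgebra (ZMod p) (langMap p (resMatrix e x))

/-- The ring `F_p[A, U^d] = F_p[A][U^d]`, as an algebra over `F_p[A]`. -/
noncomputable def topRing (e : Module.Basis (Fin n) (ZMod p) F) (x : Fin n → Ω) (d : ℕ) :
    Subalgebra (baseRing e x) Ω :=
  matrixAlgebra (baseRing e x) (resMatrix e x ^ d)

end Extension

/-!
Write `E_B = B ⊗ F` for a commutative `F_p`-algebra `B`, where `F` is the field with `p ^ n`
elements. The `B`-points of the torus are the units of `E_B`; the matrix of such a unit `y` is that
of multiplication by `y`, and raising its entries to the `p`-th power applies the partial Frobenius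
`Φ : b ⊗ z ↦ b ^ p ⊗ z` to `y`. So `U` and `A` correspond to a unit `u` over the function field and
to `a = u / Φ(u)`, and `F_p[A]`, `F_p[A, U^d]` are generated by the coordinates of `a`, `a⁻¹` and of
`u ^ d`, `u ^ (-d)` (`matrixAlgebra_le_iff`). As `Φ^n` is the `p ^ n`-power map, the norm
`a Φ(a) ⋯ Φ^{n-1}(a)` equals `u ^ (1 - p ^ n)` (`prod_relFrob_mul_pow`); hence `u ^ d` is, up to
inversion, a `2 ^ m`-th root of an element of `E_R` with `R = F_p[A]`, and after the extension of
scalars to `F` the extension is of Kummer type.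

* `R` is a localized polynomial ring: the indeterminates are integral over `R`, so the `n`
  coordinates of `a` are algebraically independent, and `R` is isomorphic to the coordinate ring of
  the torus (`algebraicIndependent_langPoint`, `baseRingEquiv`).
* The extension is Galois: the group acts by `u ↦ χ(g) u` with `χ` a faithful character with values
  in `Fˣ`, which fixes `a`. Inside `E_Ω`, with `Ω` the function field, every element of
  `S = F_p[A, U^d]` is a polynomial in `u ^ d` over `E_R` (`topRing_le_kummerRing`), so
  averaging over the group maps `S` to `R`; and the unit `u ^ d`, an eigenvector for a faithful
  character, rules out nontrivial inertia.
* The extension is generic: for a Galois algebra `M/L`, a form of Hilbert's Theorem 90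
  (`exists_unit_eigenvector`) gives a unit `v` of `E_M` with `g v = χ(g) v`. Sending `u` to `v`
  defines an equivariant homomorphism `S → M`, under which `a` goes to the invariant unit
  `v / Φ(v)`, so that `R` goes to `L`. An equivariant homomorphism between rings with invariants
  `L`, the first of which has an invertible eigenvector for a faithful character, is bijective
  (`bijective_of_equivariant`), so `L ⊗ S ≅ M`.
-/

/-! ### Extension of scalars to a finite algebra -/

section Coordinates

variable {K F : Type*} [Field K] [Field F] [Algebra K F] {n : ℕ}
variable {B C D : Type*} [CommRing B] [Algebra K B] [CommRing C] [Algebra K C]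
  [CommRing D] [Algebra K D]

/-- The functoriality of `B ↦ B ⊗ F` in the `K`-algebra `B`. -/
noncomputable def extMap (F : Type*) [Field F] [Algebra K F] (f : B →ₐ[K] C) :
    B ⊗[K] F →ₐ[K] C ⊗[K] F :=
  Algebra.TensorProduct.map f (AlgHom.id K F)

/-- The coordinates of an element of `B ⊗ F` in the `K`-basis `e` of `F`. -/
noncomputable def coord (e : Module.Basis (Fin n) K F) (y : B ⊗[K] F) : Fin n → B :=
  (Algebra.TensorProduct.basis B e).equivFun y

/-- The element of `B ⊗ F` with prescribed coordinates in the `K`-basis `e` of `F`. -/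
noncomputable def ofCoord (e : Module.Basis (Fin n) K F) (x : Fin n → B) : B ⊗[K] F :=
  (Algebra.TensorProduct.basis B e).equivFun.symm x

variable (e : Module.Basis (Fin n) K F)

@[simp] lemma coord_ofCoord (x : Fin n → B) : coord e (ofCoord e x) = x :=
  LinearEquiv.apply_symm_apply _ _

@[simp] lemma ofCoord_coord (y : B ⊗[K] F) : ofCoord e (coord e y) = y :=
  LinearEquiv.symm_apply_apply _ _

lemma coord_injective : Function.Injective (coord e : B ⊗[K] F → Fin n → B) :=
  (Algebra.TensorProduct.basis B e).equivFun.injective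

lemma ofCoord_eq_sum (x : Fin n → B) : ofCoord e x = ∑ k, x k ⊗ₜ[K] e k := by
  simp [ofCoord, Module.Basis.equivFun_symm_apply, TensorProduct.smul_tmul']

lemma coord_add (y z : B ⊗[K] F) : coord e (y + z) = coord e y + coord e z := by
  simp [coord]

lemma coord_tmul (b : B) (z : F) (k : Fin n) :
    coord e (b ⊗ₜ[K] z) k = b * algebraMap K B (e.repr z k) := by
  simp [coord]

lemma coord_tmul_basis (b : B) (k : Fin n) : coord e (b ⊗ₜ[K] e k) k = b := by
  simp [coord_tmul]

@[simp] lemma extMap_tmul (f : B →ₐ[K] C) (b : B) (z : F) :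
    extMap F f (b ⊗ₜ[K] z) = f b ⊗ₜ[K] z := by
  simp [extMap]

lemma coord_extMap (f : B →ₐ[K] C) (y : B ⊗[K] F) (k : Fin n) :
    coord e (extMap F f y) k = f (coord e y k) := by
  induction y with
  | zero => simp [coord]
  | tmul b z => simp [coord_tmul]
  | add y z hy hz => simp [coord_add, hy, hz]

lemma extMap_ofCoord (f : B →ₐ[K] C) (x : Fin n → B) :
    extMap F f (ofCoord e x) = ofCoord e (fun k => f (x k)) := by
  apply coord_injective e
  ext k
  simp [coord_extMap]

lemma extMap_comp (g : C →ₐ[K] D) (f : B →ₐ[K] C) (y : B ⊗[K] F) :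
    extMap F (g.comp f) y = extMap F g (extMap F f y) := by
  induction y with
  | zero => simp
  | tmul b z => simp
  | add y z hy hz => simp [hy, hz]

@[simp] lemma extMap_id (y : B ⊗[K] F) : extMap F (AlgHom.id K B) y = y := by
  simp [extMap]

lemma extMap_injective (e : Module.Basis (Fin n) K F) (f : B →ₐ[K] C) (hf : Function.Injective f) :
    Function.Injective (extMap F f) := by
  intro y z h
  apply coord_injective e
  ext k
  apply hf
  rw [← coord_extMap, ← coord_extMap, h]

/-- An element of `C ⊗ F` comes from `B ⊗ F` as soon as its coordinates come from `B`. -/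
lemma mem_range_extMap (f : B →ₐ[K] C) (y : C ⊗[K] F) :
    y ∈ (extMap F f).range ↔ ∀ k, coord e y k ∈ f.range := by
  constructor
  · rintro ⟨z, rfl⟩ k
    exact ⟨coord e z k, (coord_extMap e f z k).symm⟩
  · intro h
    choose b hb using h
    refine ⟨ofCoord e b, ?_⟩
    change extMap F f (ofCoord e b) = y
    rw [extMap_ofCoord]
    have : (fun k => f (b k)) = coord e y := funext hb
    rw [this, ofCoord_coord]

lemma leftMulMatrix_tmul (z : F) :
    Algebra.leftMulMatrix (Algebra.TensorProduct.basis B e) ((1 : B) ⊗ₜ[K] z) =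
      (Algebra.leftMulMatrix e z).map (algebraMap K B) := by
  ext i j
  simp [Algebra.leftMulMatrix_eq_repr_mul]

/-- The general matrix of the torus is the matrix of multiplication by an element of `B ⊗ F`. -/
lemma resMatrix_eq_leftMulMatrix (x : Fin n → B) :
    resMatrix e x = Algebra.leftMulMatrix (Algebra.TensorProduct.basis B e) (ofCoord e x) := by
  rw [ofCoord_eq_sum, map_sum, resMatrix]
  refine Finset.sum_congr rfl fun k _ => ?_
  rw [← leftMulMatrix_tmul, ← map_smul, TensorProduct.smul_tmul', smul_eq_mul, mul_one]

lemma leftMulMatrix_eq_resMatrix (y : B ⊗[K] F) :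
    Algebra.leftMulMatrix (Algebra.TensorProduct.basis B e) y = resMatrix e (coord e y) := by
  rw [resMatrix_eq_leftMulMatrix, ofCoord_coord]

lemma resMatrix_map (f : B →ₐ[K] C) (x : Fin n → B) :
    (resMatrix e x).map f = resMatrix e (fun k => f (x k)) := by
  ext i j
  simp [resMatrix, Matrix.sum_apply]

lemma leftMulMatrix_extMap (f : B →ₐ[K] C) (y : B ⊗[K] F) :
    Algebra.leftMulMatrix (Algebra.TensorProduct.basis C e) (extMap F f y) =
      (Algebra.leftMulMatrix (Algebra.TensorProduct.basis B e) y).map f := by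
  rw [leftMulMatrix_eq_resMatrix, leftMulMatrix_eq_resMatrix, resMatrix_map]
  congr 1
  ext k
  exact coord_extMap e f y k

lemma isUnit_iff_isUnit_det (y : B ⊗[K] F) :
    IsUnit y ↔ IsUnit (Algebra.leftMulMatrix (Algebra.TensorProduct.basis B e) y).det := by
  constructor
  · intro h
    rw [← Matrix.isUnit_iff_isUnit_det]
    exact h.map _
  · intro h
    rw [← Matrix.isUnit_iff_isUnit_det] at h
    obtain ⟨N, hN⟩ := h.exists_right_inv
    -- multiplication by `y` is surjective, so it attains `1`
    refine IsUnit.of_mul_eq_one (ofCoord e (N.mulVec (coord e 1))) ?_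
    apply coord_injective e
    have := Algebra.leftMulMatrix_mulVec_repr (Algebra.TensorProduct.basis B e) y
      (ofCoord e (N.mulVec (coord e 1)))
    change coord e _ = _
    change Matrix.mulVec _ (coord e _) = coord e _ at this
    rw [← this, coord_ofCoord, Matrix.mulVec_mulVec, hN, Matrix.one_mulVec]

end Coordinates

/-! ### The coordinate ring of the torus -/

section TorusRing

variable {K F : Type*} [Field K] [Field F] [Algebra K F] {n : ℕ}
variable {B C : Type*} [CommRing B] [Algebra K B] [CommRing C] [Algebra K C]
variable (e : Module.Basis (Fin n) K F)

/-- The determinant of the general element of the torus, a polynomial in its coordinates. -/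
noncomputable def torusDet : MvPolynomial (Fin n) K :=
  (resMatrix e (MvPolynomial.X : Fin n → MvPolynomial (Fin n) K)).det

/-- The coordinate ring `K[x₁, …, x_n, 1 / det]` of the torus. -/
abbrev TorusRing : Type _ := Localization.Away (torusDet e)

lemma map_torusDet (f : MvPolynomial (Fin n) K →ₐ[K] B) :
    f (torusDet e) = (resMatrix e (fun k => f (MvPolynomial.X k))).det := by
  rw [torusDet, ← resMatrix_map]
  exact f.map_det _

lemma torusDet_ne_zero : torusDet e ≠ 0 := by
  intro h
  have h1 := map_torusDet e (MvPolynomial.aeval (coord e (1 : K ⊗[K] F)))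
  simp only [MvPolynomial.aeval_X, h, map_zero] at h1
  rw [← leftMulMatrix_eq_resMatrix, map_one, Matrix.det_one] at h1
  exact zero_ne_one h1

/-- The universal point of the torus, defined over its coordinate ring. -/
noncomputable def univPoint : TorusRing e ⊗[K] F :=
  ofCoord e (fun k => algebraMap (MvPolynomial (Fin n) K) (TorusRing e) (MvPolynomial.X k))

lemma isUnit_univPoint : IsUnit (univPoint e) := by
  rw [isUnit_iff_isUnit_det e, univPoint, ← resMatrix_eq_leftMulMatrix]
  have h := map_torusDet e (IsScalarTower.toAlgHom K (MvPolynomial (Fin n) K) (TorusRing e))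
  simp only [IsScalarTower.coe_toAlgHom'] at h
  rw [← h]
  exact IsLocalization.Away.algebraMap_isUnit _

/-- The `K`-algebra homomorphism from the coordinate ring of the torus that corresponds to a
`B`-point `y` of the torus. -/
noncomputable def evalPoint (y : (B ⊗[K] F)ˣ) : TorusRing e →ₐ[K] B :=
  IsLocalization.liftAlgHom (M := Submonoid.powers (torusDet e))
    (f := MvPolynomial.aeval (coord e (y : B ⊗[K] F))) (by
      rintro ⟨_, k, rfl⟩
      rw [map_pow, map_torusDet]
      simp only [MvPolynomial.aeval_X]
      rw [← leftMulMatrix_eq_resMatrix]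
      exact ((isUnit_iff_isUnit_det e _).1 y.isUnit).pow k)

lemma evalPoint_algebraMap (y : (B ⊗[K] F)ˣ) (f : MvPolynomial (Fin n) K) :
    evalPoint e y (algebraMap _ (TorusRing e) f) =
      MvPolynomial.aeval (coord e (y : B ⊗[K] F)) f := by
  simp [evalPoint]

@[simp] lemma extMap_evalPoint (y : (B ⊗[K] F)ˣ) :
    extMap F (evalPoint e y) (univPoint e) = y := by
  rw [univPoint, extMap_ofCoord]
  simp [evalPoint_algebraMap]

/-- A homomorphism from the coordinate ring of the torus is determined by the image of the
universal point. -/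
lemma torusRing_hom_ext {f g : TorusRing e →ₐ[K] B}
    (h : extMap F f (univPoint e) = extMap F g (univPoint e)) : f = g := by
  refine IsLocalization.algHom_ext (Submonoid.powers (torusDet e)) (MvPolynomial.algHom_ext ?_)
  intro k
  have h1 := congrFun (congrArg (coord e) h) k
  rwa [coord_extMap, coord_extMap, univPoint, coord_ofCoord] at h1

lemma comp_evalPoint (f : B →ₐ[K] C) (y : (B ⊗[K] F)ˣ) (z : (C ⊗[K] F)ˣ)
    (h : extMap F f y = z) : f.comp (evalPoint e y) = evalPoint e z := by
  apply torusRing_hom_ext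
  rw [extMap_comp, extMap_evalPoint, extMap_evalPoint, h]

lemma evalPoint_injective {L : Type*} [Field L] [Algebra K L] (y : (L ⊗[K] F)ˣ)
    (h : AlgebraicIndependent K (coord e (y : L ⊗[K] F))) :
    Function.Injective (evalPoint e y) := by
  rw [injective_iff_map_eq_zero]
  intro q hq
  obtain ⟨⟨f, s⟩, rfl⟩ := IsLocalization.mk'_surjective (Submonoid.powers (torusDet e)) q
  have h1 := congrArg (evalPoint e y) (IsLocalization.mk'_spec (TorusRing e) f s)
  rw [map_mul, hq, zero_mul, evalPoint_algebraMap] at h1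
  have hf : f = 0 := (injective_iff_map_eq_zero _).1 h f h1.symm
  simp [hf]

lemma leftMulMatrix_apply_mem {R Ω : Type*} [CommRing R] [CommRing Ω] [Algebra R Ω]
    [Algebra K Ω] (T : Subalgebra R Ω) (hK : ∀ c : K, algebraMap K Ω c ∈ T) {z : Ω ⊗[K] F}
    (hz : ∀ k, coord e z k ∈ T) (i j : Fin n) :
    Algebra.leftMulMatrix (Algebra.TensorProduct.basis Ω e) z i j ∈ T := by
  rw [leftMulMatrix_eq_resMatrix, resMatrix, Matrix.sum_apply]
  exact T.sum_mem fun k _ => T.mul_mem (hz k) (hK _)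

lemma det_mem {R Ω : Type*} [CommRing R] [CommRing Ω] [Algebra R Ω] (T : Subalgebra R Ω)
    {Z : Matrix (Fin n) (Fin n) Ω} (hZ : ∀ i j, Z i j ∈ T) : Z.det ∈ T := by
  rw [Matrix.det_apply]
  refine T.sum_mem fun σ _ => ?_
  rw [Units.smul_def]
  exact T.zsmul_mem (T.prod_mem fun i _ => hZ _ _) _

/-- `R[X]`, for the matrix `X` of a point `y` of the torus, is generated by the coordinates of `y`
and `y⁻¹`. -/
lemma matrixAlgebra_le_iff {R Ω : Type*} [CommRing R] [Field Ω] [Algebra K R] [Algebra R Ω]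
    [Algebra K Ω] [IsScalarTower K R Ω] (y : (Ω ⊗[K] F)ˣ) (T : Subalgebra R Ω) :
    matrixAlgebra R (Algebra.leftMulMatrix (Algebra.TensorProduct.basis Ω e) y) ≤ T ↔
      (∀ k, coord e (y : Ω ⊗[K] F) k ∈ T) ∧ ∀ k, coord e (↑y⁻¹ : Ω ⊗[K] F) k ∈ T := by
  set X := Algebra.leftMulMatrix (Algebra.TensorProduct.basis Ω e) (y : Ω ⊗[K] F) with hX
  set Y := Algebra.leftMulMatrix (Algebra.TensorProduct.basis Ω e) (↑y⁻¹ : Ω ⊗[K] F) with hY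
  have hXY : X * Y = 1 := by rw [hX, hY, ← map_mul, Units.mul_inv, map_one]
  have hK : ∀ c : K, algebraMap K Ω c ∈ T := fun c => by
    rw [IsScalarTower.algebraMap_apply K R Ω]
    exact T.algebraMap_mem _
  -- coordinates of `z` are `K`-combinations of matrix entries, and conversely
  have hcoord : ∀ (z : Ω ⊗[K] F) (k : Fin n),
      (∀ i j, Algebra.leftMulMatrix (Algebra.TensorProduct.basis Ω e) z i j ∈ T) →
      coord e z k ∈ T := by
    intro z k hz
    have h1 := congrFun (Algebra.leftMulMatrix_mulVec_repr (Algebra.TensorProduct.basis Ω e) z 1) k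
    rw [mul_one] at h1
    change _ = coord e z k at h1
    rw [← h1]
    change ∑ j, Algebra.leftMulMatrix (Algebra.TensorProduct.basis Ω e) z k j * coord e 1 j ∈ T
    refine T.sum_mem fun j _ => T.mul_mem (hz _ _) ?_
    change coord e (1 ⊗ₜ[K] 1) j ∈ T
    rw [coord_tmul, one_mul]
    exact hK _
  have hdetXY : X.det * Y.det = 1 := by rw [← Matrix.det_mul, hXY, Matrix.det_one]
  have hdetY : Y.det = X.det⁻¹ := eq_inv_of_mul_eq_one_right hdetXY
  rw [matrixAlgebra, Algebra.adjoin_le_iff, Set.insert_subset_iff]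
  constructor
  · rintro ⟨h1, h2⟩
    have hXT : ∀ i j, X i j ∈ T := fun i j => h2 ⟨i, j, rfl⟩
    refine ⟨fun k => hcoord _ k hXT, fun k => hcoord _ k ?_⟩
    intro i j
    have : Y = X.det⁻¹ • X.adjugate := by
      have h3 : X⁻¹ = Y := Matrix.inv_eq_right_inv hXY
      rw [← h3, Matrix.inv_def, Ring.inverse_eq_inv']
    change Y i j ∈ T
    rw [this, Matrix.smul_apply, smul_eq_mul, Matrix.adjugate_apply]
    refine T.mul_mem h1 (det_mem T  fun i' j' => ?_)
    rw [Matrix.updateRow_apply]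
    split
    · rw [Pi.single_apply]
      split
      · exact T.one_mem
      · exact T.zero_mem
    · exact hXT _ _
  · rintro ⟨h1, h2⟩
    refine ⟨?_, ?_⟩
    · rw [← hdetY]
      exact det_mem T  (leftMulMatrix_apply_mem e T hK h2)
    · rintro _ ⟨i, j, rfl⟩
      exact leftMulMatrix_apply_mem e T hK h1 i j

lemma coord_mem_matrixAlgebra {R Ω : Type*} [CommRing R] [Field Ω] [Algebra K R] [Algebra R Ω]
    [Algebra K Ω] [IsScalarTower K R Ω] (y : (Ω ⊗[K] F)ˣ) (k : Fin n) :
    coord e (y : Ω ⊗[K] F) k ∈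
      matrixAlgebra R (Algebra.leftMulMatrix (Algebra.TensorProduct.basis Ω e) (y : Ω ⊗[K] F)) :=
  ((matrixAlgebra_le_iff e y _).1 le_rfl).1 k

lemma coord_inv_mem_matrixAlgebra {R Ω : Type*} [CommRing R] [Field Ω] [Algebra K R]
    [Algebra R Ω] [Algebra K Ω] [IsScalarTower K R Ω] (y : (Ω ⊗[K] F)ˣ) (k : Fin n) :
    coord e (↑y⁻¹ : Ω ⊗[K] F) k ∈
      matrixAlgebra R (Algebra.leftMulMatrix (Algebra.TensorProduct.basis Ω e) (y : Ω ⊗[K] F)) :=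
  ((matrixAlgebra_le_iff e y _).1 le_rfl).2 k

end TorusRing

/-! ### Eigenspaces of a cyclic group acting on `B ⊗ F` -/

section Eigen

variable {K F : Type*} [Field K] [Field F] [Algebra K F] {n : ℕ}
variable {B C L : Type*} [CommRing B] [Algebra K B] [CommRing C] [Algebra K C]
  [CommRing L] [Algebra K L]
variable {G : Type*} [Group G]

lemma extMap_algHom_mul (ρ : G →* (B →ₐ[K] B)) (g h : G) (y : B ⊗[K] F) :
    extMap F (ρ (g * h)) y = extMap F (ρ g) (extMap F (ρ h) y) := by
  rw [map_mul, ← extMap_comp]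
  rfl

/-- If the fixed ring of `G` in `B` comes from `L`, then the fixed ring of `G` in `B ⊗ F` comes
from `L ⊗ F`. -/
lemma mem_range_extMap_of_fixed (e : Module.Basis (Fin n) K F) (ρ : G →* (B →ₐ[K] B))
    (i : L →ₐ[K] B) (hfix : ∀ b, (∀ g, ρ g b = b) → b ∈ i.range) {y : B ⊗[K] F}
    (hy : ∀ g, extMap F (ρ g) y = y) : y ∈ (extMap F i).range := by
  rw [mem_range_extMap e]
  intro k
  apply hfix
  intro g
  rw [← coord_extMap, hy]

variable [Fintype G]

/-- The component of `y` in the `χ ^ k`-eigenspace of `G`, meaningful when `|G|` is invertible in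
`K`. For `k = 0` this is the average of `y` over `G`. -/
noncomputable def eigenPart (ρ : G →* (B →ₐ[K] B)) (χ : G →* Fˣ) (k : ℕ) (y : B ⊗[K] F) :
    B ⊗[K] F :=
  (Fintype.card G : K)⁻¹ • ∑ g, ((1 : B) ⊗ₜ[K] (χ g⁻¹ : F)) ^ k * extMap F (ρ g) y

lemma extMap_eigenPart (ρ : G →* (B →ₐ[K] B)) (χ : G →* Fˣ) (k : ℕ) (y : B ⊗[K] F) (h : G) :
    extMap F (ρ h) (eigenPart ρ χ k y) = ((1 : B) ⊗ₜ[K] (χ h : F)) ^ k * eigenPart ρ χ k y := by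
  rw [eigenPart, map_smul, map_sum, mul_smul_comm, Finset.mul_sum]
  congr 1
  refine Fintype.sum_equiv (Equiv.mulLeft h) _ _ fun g => ?_
  rw [map_mul, map_pow, extMap_tmul, map_one, ← extMap_algHom_mul, Equiv.coe_mulLeft, ← mul_assoc,
    ← mul_pow, Algebra.TensorProduct.tmul_mul_tmul, mul_one, ← Units.val_mul, ← map_mul]
  simp

lemma sum_eigenPart (ρ : G →* (B →ₐ[K] B)) (χ : G →* Fˣ) (hχ : Function.Injective χ)
    (hN : (Fintype.card G : K) ≠ 0) (y : B ⊗[K] F) :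
    ∑ k ∈ Finset.range (Fintype.card G), eigenPart ρ χ k y = y := by
  simp only [eigenPart]
  rw [← Finset.smul_sum, Finset.sum_comm]
  simp only [← Finset.sum_mul]
  rw [Finset.sum_eq_single 1]
  · simp only [inv_one, map_one, Units.val_one, ← Algebra.TensorProduct.one_def, one_pow,
      Finset.sum_const, Finset.card_range, nsmul_eq_mul, mul_one]
    rw [show extMap F (1 : B →ₐ[K] B) y = y from extMap_id y]
    rw [← nsmul_eq_mul, ← Nat.cast_smul_eq_nsmul K, smul_smul, inv_mul_cancel₀ hN, one_smul]
  · intro g _ hg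
    -- a geometric sum of a nontrivial root of unity in `F`
    have h1 : (χ g⁻¹ : F) ≠ 1 := by
      rw [Ne, Units.val_eq_one, map_inv, inv_eq_one]
      exact fun h => hg (hχ (h.trans (map_one χ).symm))
    have h2 : (χ g⁻¹ : F) ^ Fintype.card G = 1 := by
      rw [← Units.val_pow_eq_pow_val, ← map_pow, pow_card_eq_one, map_one, Units.val_one]
    have h3 : ∑ k ∈ Finset.range (Fintype.card G), (χ g⁻¹ : F) ^ k = 0 := by
      rw [geom_sum_eq h1, h2, sub_self, zero_div]
    have h4 : ∑ k ∈ Finset.range (Fintype.card G), ((1 : B) ⊗ₜ[K] (χ g⁻¹ : F)) ^ k =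
        (1 : B) ⊗ₜ[K] (∑ k ∈ Finset.range (Fintype.card G), (χ g⁻¹ : F) ^ k) := by
      rw [TensorProduct.tmul_sum]
      simp [Algebra.TensorProduct.tmul_pow]
    rw [h4, h3, TensorProduct.tmul_zero, zero_mul]
  · simp

lemma extMap_eigenPart_of_equivariant (ρ : G →* (B →ₐ[K] B)) (ρ' : G →* (C →ₐ[K] C))
    (Θ : B →ₐ[K] C) (hΘ : ∀ g, Θ.comp (ρ g) = (ρ' g).comp Θ) (χ : G →* Fˣ) (k : ℕ)
    (y : B ⊗[K] F) :
    extMap F Θ (eigenPart ρ χ k y) = eigenPart ρ' χ k (extMap F Θ y) := by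
  simp only [eigenPart, map_smul, map_sum, map_mul, map_pow, extMap_tmul, map_one]
  congr 1
  refine Finset.sum_congr rfl fun g _ => ?_
  rw [← extMap_comp, ← extMap_comp, hΘ]

/-- Dividing by a power of a unit of the `χ`-eigenspace brings the `χ ^ k`-eigenspace into
`L ⊗ F`. -/
lemma eigenPart_mem_range (e : Module.Basis (Fin n) K F) (ρ : G →* (B →ₐ[K] B)) (χ : G →* Fˣ)
    (i : L →ₐ[K] B) (hfix : ∀ b, (∀ g, ρ g b = b) → b ∈ i.range) (w : (B ⊗[K] F)ˣ)
    (hw : ∀ g, extMap F (ρ g) w = ((1 : B) ⊗ₜ[K] (χ g : F)) * w) (k : ℕ) (y : B ⊗[K] F) :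
    eigenPart ρ χ k y * ↑(w ^ k)⁻¹ ∈ (extMap F i).range := by
  apply mem_range_extMap_of_fixed e ρ i hfix
  intro g
  rw [← Units.mul_left_inj (w ^ k)]
  have h1 := extMap_eigenPart ρ χ k y g
  have h2 : extMap F (ρ g) (↑(w ^ k)⁻¹ : B ⊗[K] F) * extMap F (ρ g) (↑(w ^ k) : B ⊗[K] F) = 1 := by
    rw [← map_mul, Units.inv_mul, map_one]
  have h3 : extMap F (ρ g) (↑(w ^ k) : B ⊗[K] F) =
      ((1 : B) ⊗ₜ[K] (χ g : F)) ^ k * ↑(w ^ k) := by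
    rw [Units.val_pow_eq_pow_val, map_pow, hw, mul_pow]
  rw [mul_assoc, Units.inv_mul, mul_one, map_mul, h1]
  rw [h3] at h2
  linear_combination (eigenPart ρ χ k y) * h2

/-- An equivariant homomorphism between two rings with the same fixed ring, both of which have an
invertible eigenvector for a faithful character, is bijective. -/
lemma bijective_of_equivariant (e : Module.Basis (Fin n) K F) (ρ : G →* (B →ₐ[K] B))
    (ρ' : G →* (C →ₐ[K] C)) (χ : G →* Fˣ) (hχ : Function.Injective χ)
    (hN : (Fintype.card G : K) ≠ 0) (i : L →ₐ[K] B) (i' : L →ₐ[K] C)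
    (hfix : ∀ b, (∀ g, ρ g b = b) → b ∈ i.range) (hfix' : ∀ c, (∀ g, ρ' g c = c) → c ∈ i'.range)
    (hi' : Function.Injective i') (Θ : B →ₐ[K] C) (hΘ : ∀ g, Θ.comp (ρ g) = (ρ' g).comp Θ)
    (hΘi : Θ.comp i = i') (w : (B ⊗[K] F)ˣ)
    (hw : ∀ g, extMap F (ρ g) w = ((1 : B) ⊗ₜ[K] (χ g : F)) * w) : Function.Bijective Θ := by
  obtain ⟨k₀⟩ := e.index_nonempty
  constructor
  · rw [injective_iff_map_eq_zero]
    intro t ht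
    have h0 : extMap F Θ (t ⊗ₜ[K] e k₀) = 0 := by rw [extMap_tmul, ht, TensorProduct.zero_tmul]
    have h1 : ∀ k, eigenPart ρ χ k (t ⊗ₜ[K] e k₀) = 0 := by
      intro k
      obtain ⟨l, hl⟩ := eigenPart_mem_range e ρ χ i hfix w hw k (t ⊗ₜ[K] e k₀)
      change extMap F i l = _ at hl
      have h2 := congrArg (extMap F Θ) hl
      rw [← extMap_comp, hΘi, map_mul, extMap_eigenPart_of_equivariant ρ ρ' Θ hΘ, h0] at h2
      have h3 : eigenPart ρ' χ k (0 : C ⊗[K] F) = 0 := by simp [eigenPart]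
      rw [h3, zero_mul] at h2
      have h4 : l = 0 := (injective_iff_map_eq_zero _).1 (extMap_injective e i' hi') l h2
      rw [h4, map_zero] at hl
      exact ((Units.mul_left_eq_zero _).1 hl.symm)
    have h2 : t ⊗ₜ[K] e k₀ = (0 : B ⊗[K] F) := by
      rw [← sum_eigenPart ρ χ hχ hN (t ⊗ₜ[K] e k₀)]
      exact Finset.sum_eq_zero fun k _ => h1 k
    rw [← coord_tmul_basis e t k₀, h2]
    simp [coord]
  · intro c
    let w' : (C ⊗[K] F)ˣ := Units.map (extMap F Θ : B ⊗[K] F →* C ⊗[K] F) w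
    have hw' : ∀ g, extMap F (ρ' g) w' = ((1 : C) ⊗ₜ[K] (χ g : F)) * w' := by
      intro g
      change extMap F (ρ' g) (extMap F Θ w) = _ * extMap F Θ w
      rw [← extMap_comp, ← hΘ, extMap_comp, hw, map_mul, extMap_tmul, map_one]
    have h1 : c ⊗ₜ[K] e k₀ ∈ (extMap F Θ).range := by
      rw [← sum_eigenPart ρ' χ hχ hN (c ⊗ₜ[K] e k₀)]
      refine sum_mem fun k _ => ?_
      obtain ⟨l, hl⟩ := eigenPart_mem_range e ρ' χ i' hfix' w' hw' k (c ⊗ₜ[K] e k₀)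
      change extMap F i' l = _ at hl
      refine ⟨extMap F i l * ↑(w ^ k), ?_⟩
      change extMap F Θ _ = _
      rw [map_mul, ← extMap_comp, hΘi, hl, mul_assoc]
      have : extMap F Θ ↑(w ^ k) = ↑(w' ^ k) := by
        rw [Units.val_pow_eq_pow_val, map_pow, Units.val_pow_eq_pow_val]
        rfl
      rw [this, Units.inv_mul, mul_one]
    rw [mem_range_extMap e] at h1
    have h2 := h1 k₀
    rw [coord_tmul_basis] at h2
    exact h2

end Eigen

/-! ### Invertible eigenvectors in Galois algebras -/

section HilbertNinety

variable {K F : Type*} [Field K] [Field F] [Algebra K F] {n : ℕ}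
variable {G : Type*} [Group G] [Fintype G]

variable {M L : Type*} [CommRing M] [Algebra K M] [Field L] [Algebra K L]

lemma eigenPart_pow_eigen (ρ : G →* (M →ₐ[K] M)) (χ : G →* Fˣ) {k : ℕ} {y : M ⊗[K] F}
    (hy : ∀ g, extMap F (ρ g) y = ((1 : M) ⊗ₜ[K] (χ g : F)) ^ k * y) {j : ℕ}
    (hj : k * j ≡ 1 [MOD Fintype.card G]) (g : G) :
    extMap F (ρ g) (y ^ j) = ((1 : M) ⊗ₜ[K] (χ g : F)) * y ^ j := by
  have h1 : (χ g : F) ^ (k * j) = χ g := by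
    rw [← Units.val_pow_eq_pow_val, ← map_pow]
    congr 2
    conv_rhs => rw [← pow_one g]
    rw [pow_eq_pow_iff_modEq]
    exact hj.of_dvd (orderOf_dvd_card)
  rw [map_pow, hy, mul_pow, ← pow_mul, Algebra.TensorProduct.tmul_pow, h1, one_pow]

/-- No maximal ideal `𝔪` of `M ⊗ F` contains the whole `χ`-eigenspace. Let `h` have order two. As
`h` acts by `(-1) ^ k` on the `χ ^ k`-eigenspace and nontrivially modulo `𝔪`, some
`χ ^ k`-eigenspace with `k` odd is not contained in `𝔪`; and a power of an element of it is a
`χ`-eigenvector. -/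
lemma exists_eigenvector_notMem (ρ : G →* (M →ₐ[K] M)) (χ : G →* Fˣ)
    (hχ : Function.Injective χ) [FiniteDimensional K F] {m : ℕ} (hm : m ≠ 0)
    (hG : Fintype.card G = 2 ^ m) (h2 : (2 : K) ≠ 0)
    (hfree : ∀ I : Ideal M, I.IsMaximal → ∀ g : G, g ≠ 1 → ∃ s : M, ρ g s - s ∉ I)
    (𝔪 : Ideal (M ⊗[K] F)) [h𝔪 : 𝔪.IsMaximal] :
    ∃ y ∉ 𝔪, ∀ g, extMap F (ρ g) y = ((1 : M) ⊗ₜ[K] (χ g : F)) * y := by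
  have hN : (Fintype.card G : K) ≠ 0 := by
    rw [hG]; push_cast; exact pow_ne_zero _ h2
  obtain ⟨h, hh⟩ := exists_prime_orderOf_dvd_card 2 (hG ▸ dvd_pow_self 2 hm : 2 ∣ Fintype.card G)
  have hh1 : h ≠ 1 := by
    rintro rfl
    simp at hh
  have hχh : (χ h : F) = -1 := by
    have h3 : (χ h : F) ^ 2 = 1 := by
      rw [← Units.val_pow_eq_pow_val, ← map_pow, ← hh, pow_orderOf_eq_one, map_one, Units.val_one]
    rcases sq_eq_one_iff.1 h3 with h4 | h4
    · exact absurd (hχ ((Units.val_eq_one.1 h4).trans (map_one χ).symm)) hh1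
    · exact h4
  have hI : (𝔪.comap (algebraMap M (M ⊗[K] F))).IsMaximal :=
    Ideal.isMaximal_comap_of_isIntegral_of_isMaximal 𝔪
  obtain ⟨s, hs⟩ := hfree _ hI h hh1
  rw [Ideal.mem_comap] at hs
  -- some eigencomponent of `s` for an odd power of `χ` lies outside `𝔪`
  obtain ⟨k, hk, hk𝔪⟩ : ∃ k, Odd k ∧ eigenPart ρ χ k (s ⊗ₜ[K] (1 : F)) ∉ 𝔪 := by
    by_contra! hcon
    apply hs
    have h5 : algebraMap M (M ⊗[K] F) (ρ h s - s) =
        ∑ k ∈ Finset.range (Fintype.card G),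
          (extMap F (ρ h) (eigenPart ρ χ k (s ⊗ₜ[K] (1 : F))) -
            eigenPart ρ χ k (s ⊗ₜ[K] (1 : F))) := by
      rw [Finset.sum_sub_distrib, ← map_sum, sum_eigenPart ρ χ hχ hN, extMap_tmul, map_sub]
      rfl
    rw [h5]
    refine sum_mem fun k _ => ?_
    rw [extMap_eigenPart, hχh, TensorProduct.tmul_neg, ← Algebra.TensorProduct.one_def]
    rcases Nat.even_or_odd k with hk | hk
    · rw [hk.neg_one_pow, one_mul, sub_self]
      exact 𝔪.zero_mem
    · exact sub_mem (𝔪.mul_mem_left _ (hcon k hk)) (hcon k hk)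
  obtain ⟨j, hj⟩ : ∃ j, k * j ≡ 1 [MOD Fintype.card G] := by
    rw [hG]
    have hc : Nat.Coprime k (2 ^ m) := (Nat.coprime_two_right.2 hk).pow_right m
    obtain ⟨j, hj⟩ := Nat.exists_mul_mod_eq_one_of_coprime hc (Nat.one_lt_two_pow hm)
    refine ⟨j, ?_⟩
    rw [Nat.ModEq, hj.2, Nat.mod_eq_of_lt (Nat.one_lt_two_pow hm)]
  exact ⟨_, fun h6 => hk𝔪 (h𝔪.isPrime.mem_of_pow_mem j h6),
    eigenPart_pow_eigen ρ χ (extMap_eigenPart ρ χ k _) hj⟩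

/-- A case of Hilbert's Theorem 90 over the semilocal ring `L ⊗ F`: the `χ`-eigenspace of
`M ⊗ F` contains a unit. Eigenvectors that avoid a maximal ideal above each maximal ideal of `L ⊗ F`
are glued by the Chinese remainder theorem; the `|G|`-th power of the result lies in `L ⊗ F` and
outside all maximal ideals there. -/
lemma exists_unit_eigenvector (e : Module.Basis (Fin n) K F) (ρ : G →* (M →ₐ[K] M))
    (χ : G →* Fˣ) (hχ : Function.Injective χ) {m : ℕ} (hm : m ≠ 0)
    (hG : Fintype.card G = 2 ^ m) (h2 : (2 : K) ≠ 0)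
    (i : L →ₐ[K] M) (hi : Function.Injective i) (hiρ : ∀ g l, ρ g (i l) = i l)
    (hfix : ∀ b, (∀ g, ρ g b = b) → b ∈ i.range)
    (hfree : ∀ I : Ideal M, I.IsMaximal → ∀ g : G, g ≠ 1 → ∃ s : M, ρ g s - s ∉ I) :
    ∃ v : (M ⊗[K] F)ˣ, ∀ g, extMap F (ρ g) v = ((1 : M) ⊗ₜ[K] (χ g : F)) * v := by
  classical
  have : FiniteDimensional K F := Module.Finite.of_basis e
  have hN : (Fintype.card G : K) ≠ 0 := by
    rw [hG]; push_cast; exact pow_ne_zero _ h2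
  have hart : IsArtinianRing (L ⊗[K] F) := IsArtinianRing.of_finite L _
  have hFE : ∀ (g : G) (z : L ⊗[K] F), extMap F (ρ g) (extMap F i z) = extMap F i z := by
    intro g z
    rw [← extMap_comp]
    congr 1
    congr 1
    ext l
    exact hiρ g l
  -- the `N`-th power of an eigenvector comes from `L ⊗ F`
  have hpow : ∀ y : M ⊗[K] F, (∀ g, extMap F (ρ g) y = ((1 : M) ⊗ₜ[K] (χ g : F)) * y) →
      ∃ c : L ⊗[K] F, extMap F i c = y ^ Fintype.card G := by
    intro y hy
    refine mem_range_extMap_of_fixed e ρ i hfix fun g => ?_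
    rw [map_pow, hy, mul_pow, Algebra.TensorProduct.tmul_pow, ← Units.val_pow_eq_pow_val,
      ← map_pow, pow_card_eq_one, map_one, Units.val_one, one_pow, ← Algebra.TensorProduct.one_def,
      one_mul]
  -- every maximal ideal of `L ⊗ F` lies below one of `M ⊗ F`: apply the averaging operator
  have hover : ∀ 𝔫 : Ideal (L ⊗[K] F), 𝔫 ≠ ⊤ → 𝔫.map (extMap F i) ≠ ⊤ := by
    intro 𝔫 h𝔫 htop
    apply h𝔫
    have key : ∀ y ∈ 𝔫.map (extMap F i), ∀ a, ∃ z ∈ 𝔫, extMap F i z = eigenPart ρ χ 0 (a * y) := by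
      intro y hy
      refine Submodule.span_induction ?_ ?_ ?_ ?_ hy
      · rintro _ ⟨z, hz, rfl⟩ a
        obtain ⟨c, hc⟩ := mem_range_extMap_of_fixed e ρ i hfix (y := eigenPart ρ χ 0 a)
          fun g => by rw [extMap_eigenPart, pow_zero, one_mul]
        change extMap F i c = _ at hc
        refine ⟨c * z, 𝔫.mul_mem_left _ hz, ?_⟩
        simp only [map_mul, hc, eigenPart, hFE, pow_zero, one_mul, Finset.sum_mul,
          smul_mul_assoc]
      · exact fun a => ⟨0, 𝔫.zero_mem, by simp [eigenPart]⟩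
      · intro y₁ y₂ _ _ h₁ h₂ a
        obtain ⟨z₁, hz₁, h₁⟩ := h₁ a
        obtain ⟨z₂, hz₂, h₂⟩ := h₂ a
        refine ⟨z₁ + z₂, 𝔫.add_mem hz₁ hz₂, ?_⟩
        rw [map_add, h₁, h₂]
        simp only [eigenPart, mul_add, map_add, Finset.sum_add_distrib, smul_add]
      · intro b y _ h a
        obtain ⟨z, hz, h⟩ := h (a * b)
        exact ⟨z, hz, by rw [h, smul_eq_mul, mul_assoc]⟩
    obtain ⟨z, hz, hz1⟩ := key 1 (htop ▸ Submodule.mem_top) 1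
    rw [mul_one] at hz1
    have h3 : eigenPart ρ χ 0 (1 : M ⊗[K] F) = 1 := by
      simp only [eigenPart, pow_zero, map_one, mul_one, Finset.sum_const, Finset.card_univ]
      rw [← Nat.cast_smul_eq_nsmul K, smul_smul, inv_mul_cancel₀ hN, one_smul]
    rw [h3, ← map_one (extMap F i)] at hz1
    rw [Ideal.eq_top_iff_one, ← extMap_injective e i hi hz1]
    exact hz
  have hex : ∀ 𝔫 : MaximalSpectrum (L ⊗[K] F), ∃ (𝔪 : Ideal (M ⊗[K] F)) (y : M ⊗[K] F),
      𝔪.IsPrime ∧ 𝔫.asIdeal ≤ 𝔪.comap (extMap F i) ∧ y ∉ 𝔪 ∧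
      ∀ g, extMap F (ρ g) y = ((1 : M) ⊗ₜ[K] (χ g : F)) * y := by
    intro 𝔫
    obtain ⟨𝔪, h𝔪, hle⟩ := Ideal.exists_le_maximal _ (hover _ 𝔫.isMaximal.ne_top)
    obtain ⟨y, hy, hy1⟩ := exists_eigenvector_notMem ρ χ hχ hm hG h2 hfree 𝔪
    exact ⟨𝔪, y, h𝔪.isPrime, Ideal.map_le_iff_le_comap.1 hle, hy, hy1⟩
  choose 𝔪 y hprime hle hy hyχ using hex
  have : Fintype (MaximalSpectrum (L ⊗[K] F)) := Fintype.ofFinite _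
  have hcrt : ∀ 𝔫 : MaximalSpectrum (L ⊗[K] F), ∃ x : L ⊗[K] F,
      ∀ 𝔫' : MaximalSpectrum (L ⊗[K] F), x - (if 𝔫' = 𝔫 then 1 else 0) ∈ 𝔫'.asIdeal := by
    intro 𝔫
    refine Ideal.exists_forall_sub_mem_ideal ?_ _
    intro 𝔫₁ 𝔫₂ hne
    exact Ideal.isCoprime_of_isMaximal fun h => hne (MaximalSpectrum.ext h)
  choose ε hε using hcrt
  let v := ∑ 𝔫, extMap F i (ε 𝔫) * y 𝔫
  have hv : ∀ g, extMap F (ρ g) v = ((1 : M) ⊗ₜ[K] (χ g : F)) * v := by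
    intro g
    simp only [v, map_sum, map_mul, hFE, hyχ, Finset.mul_sum]
    exact Finset.sum_congr rfl fun _ _ => by ring
  have hv𝔪 : ∀ 𝔫, v ∉ 𝔪 𝔫 := by
    intro 𝔫 hmem
    apply hy 𝔫
    have h3 : v - y 𝔫 ∈ 𝔪 𝔫 := by
      have h4 : v - y 𝔫 = ∑ 𝔫', extMap F i (ε 𝔫' - if 𝔫 = 𝔫' then 1 else 0) * y 𝔫' := by
        simp only [map_sub, sub_mul, Finset.sum_sub_distrib, v]
        congr 1
        rw [Finset.sum_eq_single 𝔫]
        · simp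
        · intro b _ hb
          simp [hb.symm]
        · simp
      rw [h4]
      refine sum_mem fun 𝔫' _ => Ideal.mul_mem_right _ _ ?_
      exact hle 𝔫 (hε 𝔫' 𝔫)
    simpa using sub_mem hmem h3
  obtain ⟨c, hc⟩ := hpow v hv
  have hcu : IsUnit c := by
    by_contra hnu
    obtain ⟨𝔫, h𝔫, hc𝔫⟩ := exists_max_ideal_of_mem_nonunits hnu
    have h3 : extMap F i c ∈ 𝔪 ⟨𝔫, h𝔫⟩ := hle ⟨𝔫, h𝔫⟩ hc𝔫
    rw [hc] at h3
    exact hv𝔪 _ ((hprime _).mem_of_pow_mem _ h3)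
  have hvu : IsUnit v := by
    have h3 : IsUnit (v ^ Fintype.card G) := hc ▸ hcu.map (extMap F i)
    exact (isUnit_pow_iff Fintype.card_ne_zero).1 h3
  exact ⟨hvu.unit, hv⟩

end HilbertNinety

/-! ### Frobenius maps and the Lang map -/

section Frobenius

variable {p : ℕ} [Fact p.Prime] {F : Type*} [Field F] [Algebra (ZMod p) F] {n : ℕ}
variable {B C : Type*} [CommRing B] [Algebra (ZMod p) B] [CommRing C] [Algebra (ZMod p) C]

/-- The absolute Frobenius endomorphism of a commutative `F_p`-algebra. -/
noncomputable def absFrob (p : ℕ) [Fact p.Prime] (B : Type*) [CommRing B] [Algebra (ZMod p) B] :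
    B →ₐ[ZMod p] B :=
  FiniteField.frobeniusAlgHom (ZMod p) B

@[simp] lemma absFrob_apply (b : B) : absFrob p B b = b ^ p := by
  simp [absFrob, ZMod.card]

/-- The partial Frobenius endomorphism `b ⊗ z ↦ b ^ p ⊗ z` of `B ⊗ F`, which raises coordinates to
the `p`-th power. -/
noncomputable def relFrob (p : ℕ) [Fact p.Prime] (B F : Type*) [CommRing B] [Algebra (ZMod p) B]
    [Field F] [Algebra (ZMod p) F] : B ⊗[ZMod p] F →ₐ[ZMod p] B ⊗[ZMod p] F :=
  extMap F (absFrob p B)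

/-- The partial Frobenius endomorphism `b ⊗ z ↦ b ⊗ z ^ p` of the `B`-algebra `B ⊗ F`. -/
noncomputable def scalarFrob (p : ℕ) [Fact p.Prime] (B F : Type*) [CommRing B]
    [Algebra (ZMod p) B] [Field F] [Algebra (ZMod p) F] : B ⊗[ZMod p] F →ₐ[B] B ⊗[ZMod p] F :=
  Algebra.TensorProduct.map (AlgHom.id B B) (absFrob p F)

@[simp] lemma relFrob_tmul (b : B) (z : F) : relFrob p B F (b ⊗ₜ z) = (b ^ p) ⊗ₜ z := by
  simp [relFrob]

@[simp] lemma scalarFrob_tmul (b : B) (z : F) : scalarFrob p B F (b ⊗ₜ z) = b ⊗ₜ (z ^ p) := by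
  simp [scalarFrob]

lemma pow_add_pow_of_zmod_algebra (k : ℕ) (x y : B) :
    (x + y) ^ p ^ k = x ^ p ^ k + y ^ p ^ k := by
  cases subsingleton_or_nontrivial B
  · exact Subsingleton.elim _ _
  · have : CharP B p := charP_of_injective_algebraMap' (ZMod p) p
    exact add_pow_char_pow x y p k

lemma scalarFrob_relFrob (y : B ⊗[ZMod p] F) : scalarFrob p B F (relFrob p B F y) = y ^ p := by
  induction y with
  | zero => simp [(Fact.out : p.Prime).ne_zero]
  | tmul b z => simp [Algebra.TensorProduct.tmul_pow]
  | add y z hy hz =>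
    rw [map_add, map_add, hy, hz]
    simpa using (pow_add_pow_of_zmod_algebra (p := p) 1 y z).symm

lemma relFrob_extMap (f : B →ₐ[ZMod p] C) (y : B ⊗[ZMod p] F) :
    relFrob p C F (extMap F f y) = extMap F f (relFrob p B F y) := by
  rw [relFrob, relFrob, ← extMap_comp, ← extMap_comp]
  congr 1
  congr 1
  ext b
  simp

lemma scalarFrob_extMap (f : B →ₐ[ZMod p] C) (y : B ⊗[ZMod p] F) :
    scalarFrob p C F (extMap F f y) = extMap F f (scalarFrob p B F y) := by
  induction y with
  | zero => simp
  | tmul b z => simp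
  | add y z hy hz => simp [hy, hz]

lemma relFrob_one_tmul (z : F) : relFrob p B F ((1 : B) ⊗ₜ z) = (1 : B) ⊗ₜ z := by simp

lemma relFrob_iterate_tmul (k : ℕ) (b : B) (z : F) :
    (relFrob p B F)^[k] (b ⊗ₜ z) = (b ^ p ^ k) ⊗ₜ z := by
  induction k with
  | zero => simp
  | succ k ih => rw [Function.iterate_succ_apply', ih, relFrob_tmul, pow_succ, pow_mul]

lemma scalarFrob_iterate_tmul (k : ℕ) (b : B) (z : F) :
    (scalarFrob p B F)^[k] (b ⊗ₜ z) = b ⊗ₜ (z ^ p ^ k) := by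
  induction k with
  | zero => simp
  | succ k ih => rw [Function.iterate_succ_apply', ih, scalarFrob_tmul, pow_succ, pow_mul]

lemma natCard_eq_of_basis (e : Module.Basis (Fin n) (ZMod p) F) : Nat.card F = p ^ n := by
  have : Module.Finite (ZMod p) F := Module.Finite.of_basis e
  rw [Module.natCard_eq_pow_finrank (K := ZMod p), Nat.card_zmod, Module.finrank_eq_card_basis e,
    Fintype.card_fin]

lemma pow_natCard_of_basis (e : Module.Basis (Fin n) (ZMod p) F) (z : F) : z ^ p ^ n = z := by
  have : Module.Finite (ZMod p) F := Module.Finite.of_basis e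
  have : Finite F := Module.finite_of_finite (ZMod p)
  have := Fintype.ofFinite F
  rw [← natCard_eq_of_basis e, Nat.card_eq_fintype_card, FiniteField.pow_card]

/-- The `n`-th iterate of the partial Frobenius is the `p ^ n`-power map, as `F` has `p ^ n`
elements. -/
lemma relFrob_iterate_eq_pow (e : Module.Basis (Fin n) (ZMod p) F) (y : B ⊗[ZMod p] F) :
    (relFrob p B F)^[n] y = y ^ p ^ n := by
  induction y with
  | zero => simp [(Fact.out : p.Prime).ne_zero]
  | tmul b z =>
    rw [relFrob_iterate_tmul, Algebra.TensorProduct.tmul_pow, pow_natCard_of_basis e]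
  | add y z hy hz =>
    rw [iterate_map_add, hy, hz, pow_add_pow_of_zmod_algebra]

/-- Galois descent along `F/F_p`: the coordinates of `y` are traces of `F`-multiples of `y`. -/
lemma sum_scalarFrob_iterate (e : Module.Basis (Fin n) (ZMod p) F) (y : B ⊗[ZMod p] F)
    (j : Fin n) :
    ∃ c : F, ∑ i ∈ Finset.range n, (scalarFrob p B F)^[i] (y * (1 : B) ⊗ₜ c) =
      algebraMap B (B ⊗[ZMod p] F) (coord e y j) := by
  have : Module.Finite (ZMod p) F := Module.Finite.of_basis e
  have : Finite F := Module.finite_of_finite (ZMod p)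
  refine ⟨e.traceDual j, ?_⟩
  induction y with
  | zero => simp [coord]
  | tmul b z =>
    have h1 := FiniteField.algebraMap_trace_eq_sum_pow (ZMod p) F (z * e.traceDual j)
    rw [Module.finrank_eq_card_basis e, Fintype.card_fin, Nat.card_zmod] at h1
    have h2 : Algebra.trace (ZMod p) F (z * e.traceDual j) = e.repr z j := by
      conv_lhs => rw [← e.sum_repr z]
      rw [Finset.sum_mul, map_sum]
      simp
    rw [h2] at h1
    simp only [Algebra.TensorProduct.tmul_mul_tmul, mul_one, scalarFrob_iterate_tmul]
    rw [← TensorProduct.tmul_sum, ← h1, coord_tmul]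
    rw [Algebra.TensorProduct.algebraMap_apply, Algebra.algebraMap_self_apply,
      Algebra.algebraMap_eq_smul_one, Algebra.algebraMap_eq_smul_one, TensorProduct.tmul_smul,
      TensorProduct.smul_tmul', mul_smul_comm, mul_one]
  | add y z hy hz =>
    simp only [add_mul, iterate_map_add, Finset.sum_add_distrib, hy, hz, coord_add, Pi.add_apply,
      map_add]

/-- The Lang map `y ↦ y / Φ(y)` on the `B`-points of the torus, with `Φ` the partial Frobenius. -/
noncomputable def langPoint (y : (B ⊗[ZMod p] F)ˣ) : (B ⊗[ZMod p] F)ˣ :=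
  y / Units.map (relFrob p B F : B ⊗[ZMod p] F →* B ⊗[ZMod p] F) y

lemma langPoint_mul_relFrob (y : (B ⊗[ZMod p] F)ˣ) :
    (langPoint y : B ⊗[ZMod p] F) * relFrob p B F y = y := by
  have h := congrArg Units.val
    (div_mul_cancel y (Units.map (relFrob p B F : B ⊗[ZMod p] F →* B ⊗[ZMod p] F) y))
  exact h

lemma eq_langPoint_of_mul_relFrob {y : (B ⊗[ZMod p] F)ˣ} {z : B ⊗[ZMod p] F}
    (h : z * relFrob p B F y = y) : z = langPoint y := by
  have h1 : IsUnit (relFrob p B F (y : B ⊗[ZMod p] F)) := y.isUnit.map _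
  exact h1.mul_left_injective (h.trans (langPoint_mul_relFrob y).symm)

lemma langPoint_inv (y : (B ⊗[ZMod p] F)ˣ) : langPoint y⁻¹ = (langPoint y)⁻¹ := by
  rw [langPoint, langPoint, map_inv, inv_div_inv, inv_div]

/-- The Lang map is natural in `B`, and insensitive to multiplication of its argument by elements
of `F`. -/
lemma extMap_langPoint (f : B →ₐ[ZMod p] C) (y : (B ⊗[ZMod p] F)ˣ) (z : (C ⊗[ZMod p] F)ˣ) (c : F)
    (hz : extMap F f y = ((1 : C) ⊗ₜ[ZMod p] c) * (z : C ⊗[ZMod p] F)) :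
    extMap F f (langPoint y) = langPoint z := by
  have h1 := congrArg (extMap F f) (langPoint_mul_relFrob y)
  rw [map_mul, ← relFrob_extMap, hz, map_mul, relFrob_one_tmul] at h1
  have hc : IsUnit ((1 : C) ⊗ₜ[ZMod p] c) := by
    have h2 : IsUnit (extMap F f y) := y.isUnit.map _
    rw [hz] at h2
    exact isUnit_of_mul_isUnit_left h2
  apply eq_langPoint_of_mul_relFrob
  apply hc.mul_right_injective
  linear_combination h1

/-- Iterating `y = a · Φ(y)`, where `a` is the image of `y` under the Lang map. -/
lemma prod_relFrob_mul (y : (B ⊗[ZMod p] F)ˣ) (k : ℕ) :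
    (∏ i ∈ Finset.range k, (relFrob p B F)^[i] (langPoint y)) * (relFrob p B F)^[k] y = y := by
  induction k with
  | zero => simp
  | succ k ih =>
    rw [Finset.prod_range_succ, mul_assoc, Function.iterate_succ_apply, ← iterate_map_mul,
      langPoint_mul_relFrob, ih]

/-- The norm of `a = y / Φ(y)` is `y ^ (1 - p ^ n)`. -/
lemma prod_relFrob_mul_pow (e : Module.Basis (Fin n) (ZMod p) F) (y : (B ⊗[ZMod p] F)ˣ) :
    (∏ i ∈ Finset.range n, (relFrob p B F)^[i] (langPoint y)) *
      (y : B ⊗[ZMod p] F) ^ (p ^ n - 1) = 1 := by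
  have h := prod_relFrob_mul y n
  rw [relFrob_iterate_eq_pow e] at h
  have h1 : p ^ n = (p ^ n - 1) + 1 :=
    (Nat.sub_add_cancel (Nat.one_le_pow _ _ (Fact.out : p.Prime).pos)).symm
  rw [h1, pow_succ, ← mul_assoc] at h
  exact y.isUnit.mul_left_injective (by simpa using h)

lemma langMap_resMatrix {Ω : Type*} [Field Ω] [Algebra (ZMod p) Ω]
    (e : Module.Basis (Fin n) (ZMod p) F) (y : (Ω ⊗[ZMod p] F)ˣ) :
    langMap p (resMatrix e (coord e (y : Ω ⊗[ZMod p] F))) =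
      Algebra.leftMulMatrix (Algebra.TensorProduct.basis Ω e) (langPoint y) := by
  rw [langMap, ← leftMulMatrix_eq_resMatrix]
  have h1 : (Algebra.leftMulMatrix (Algebra.TensorProduct.basis Ω e)
      (y : Ω ⊗[ZMod p] F)).map (· ^ p) =
      Algebra.leftMulMatrix (Algebra.TensorProduct.basis Ω e) (relFrob p Ω F y) := by
    rw [relFrob, leftMulMatrix_extMap]
    ext i j
    simp
  have h2 : IsUnit (Algebra.leftMulMatrix (Algebra.TensorProduct.basis Ω e)
      (relFrob p Ω F y)).det :=
    (isUnit_iff_isUnit_det e _).1 (y.isUnit.map _)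
  have h3 := congrArg (Algebra.leftMulMatrix (Algebra.TensorProduct.basis Ω e))
    (langPoint_mul_relFrob y)
  rw [map_mul] at h3
  rw [h1, ← h3]
  rw [Matrix.mul_nonsing_inv_cancel_right _ _ h2]

end Frobenius

/-! ### The ring `F_p[A]` -/

section BaseRing

variable {p : ℕ} [Fact p.Prime] {F : Type*} [Field F] [Algebra (ZMod p) F] {n : ℕ}
variable {Ω : Type*} [Field Ω] [Algebra (ZMod p) Ω]
variable {e : Module.Basis (Fin n) (ZMod p) F} {x : Fin n → Ω} {u : (Ω ⊗[ZMod p] F)ˣ}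

lemma baseRing_eq_matrixAlgebra (hx : coord e (u : Ω ⊗[ZMod p] F) = x) :
    baseRing e x = matrixAlgebra (ZMod p)
      (Algebra.leftMulMatrix (Algebra.TensorProduct.basis Ω e) (langPoint u)) := by
  rw [baseRing, ← hx, langMap_resMatrix]

lemma baseRing_le_iff (hx : coord e (u : Ω ⊗[ZMod p] F) = x) (T : Subalgebra (ZMod p) Ω) :
    baseRing e x ≤ T ↔ (∀ k, coord e (langPoint u : Ω ⊗[ZMod p] F) k ∈ T) ∧
      ∀ k, coord e (↑(langPoint u)⁻¹ : Ω ⊗[ZMod p] F) k ∈ T := by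
  rw [baseRing_eq_matrixAlgebra hx, matrixAlgebra_le_iff]

lemma langPoint_mem_range (hx : coord e (u : Ω ⊗[ZMod p] F) = x) :
    (langPoint u : Ω ⊗[ZMod p] F) ∈ (extMap F (baseRing e x).val).range := by
  rw [mem_range_extMap e, Subalgebra.range_val]
  exact ((baseRing_le_iff hx _).1 le_rfl).1

lemma langPoint_inv_mem_range (hx : coord e (u : Ω ⊗[ZMod p] F) = x) :
    (↑(langPoint u)⁻¹ : Ω ⊗[ZMod p] F) ∈ (extMap F (baseRing e x).val).range := by
  rw [mem_range_extMap e, Subalgebra.range_val]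
  exact ((baseRing_le_iff hx _).1 le_rfl).2

lemma relFrob_iterate_mem_range {T : Subalgebra (ZMod p) Ω} {y : Ω ⊗[ZMod p] F}
    (hy : y ∈ (extMap F T.val).range) (k : ℕ) :
    (relFrob p Ω F)^[k] y ∈ (extMap F T.val).range := by
  induction k with
  | zero => exact hy
  | succ k ih =>
    obtain ⟨z, hz⟩ := ih
    change extMap F T.val z = _ at hz
    rw [Function.iterate_succ_apply', ← hz, relFrob_extMap]
    exact ⟨_, rfl⟩

/-- `u ^ (p ^ n - 1)` is defined over `F_p[A]`, being the inverse of the norm of `u / Φ(u)`. -/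
lemma pow_mem_range (hx : coord e (u : Ω ⊗[ZMod p] F) = x) :
    (↑(u ^ (p ^ n - 1)) : Ω ⊗[ZMod p] F) ∈ (extMap F (baseRing e x).val).range := by
  have h := prod_relFrob_mul_pow e u⁻¹
  rw [← Units.val_pow_eq_pow_val, inv_pow] at h
  rw [← Units.mul_inv_eq_one.1 h]
  refine prod_mem fun i _ => relFrob_iterate_mem_range ?_ i
  rw [langPoint_inv]
  exact langPoint_inv_mem_range hx

lemma inv_pow_mem_range (hx : coord e (u : Ω ⊗[ZMod p] F) = x) :
    (↑(u ^ (p ^ n - 1))⁻¹ : Ω ⊗[ZMod p] F) ∈ (extMap F (baseRing e x).val).range := by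
  have h := prod_relFrob_mul_pow e u
  rw [← Units.val_pow_eq_pow_val] at h
  rw [← (Units.eq_inv_of_mul_eq_one_right h : _ = (↑(u ^ (p ^ n - 1))⁻¹ : Ω ⊗[ZMod p] F))]
  exact prod_mem fun i _ => relFrob_iterate_mem_range (langPoint_mem_range hx) i

lemma isIntegral_of_mem_range {T : Subalgebra (ZMod p) Ω} [Module.Finite (ZMod p) F]
    {y : Ω ⊗[ZMod p] F} (hy : y ∈ (extMap F T.val).range) : IsIntegral T y := by
  obtain ⟨z, hz⟩ := hy
  change extMap F T.val z = y at hz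
  subst hz
  induction z with
  | zero => simpa using isIntegral_zero
  | tmul t z =>
    have h1 : IsIntegral T ((1 : Ω) ⊗ₜ[ZMod p] z) :=
      ((Algebra.IsIntegral.isIntegral (R := ZMod p) z).map
        (Algebra.TensorProduct.includeRight : F →ₐ[ZMod p] Ω ⊗[ZMod p] F)).tower_top
    have h2 : extMap F T.val (t ⊗ₜ z) = t • ((1 : Ω) ⊗ₜ[ZMod p] z) := by
      rw [extMap_tmul, Algebra.smul_def]
      change _ = ((t : Ω) ⊗ₜ[ZMod p] (1 : F)) * _
      rw [Algebra.TensorProduct.tmul_mul_tmul, mul_one, one_mul]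
      rfl
    rw [h2]
    exact h1.smul t
  | add y z hy hz =>
    rw [map_add]
    exact hy.add hz

/-- The coordinates of `U` are integral over `F_p[A]`: those of `u ^ (p ^ n - 1)` lie in `F_p[A]`,
and integrality passes from an element of `Ω ⊗ F` to its coordinates. -/
lemma isIntegral_baseRing (hx : coord e (u : Ω ⊗[ZMod p] F) = x) (j : Fin n) :
    IsIntegral (baseRing e x) (x j) := by
  have : Module.Finite (ZMod p) F := Module.Finite.of_basis e
  have hn : n ≠ 0 := by
    rintro rfl
    exact e.index_nonempty.elim fun i => i.elim0
  have hpos : 0 < p ^ n - 1 := Nat.sub_pos_of_lt (Nat.one_lt_pow hn (Fact.out : p.Prime).one_lt)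
  have hu : IsIntegral (baseRing e x) (u : Ω ⊗[ZMod p] F) :=
    IsIntegral.of_pow hpos (by
      rw [← Units.val_pow_eq_pow_val]
      exact isIntegral_of_mem_range (pow_mem_range hx))
  obtain ⟨c, hc⟩ := sum_scalarFrob_iterate e (u : Ω ⊗[ZMod p] F) j
  have h1 : IsIntegral (baseRing e x) ((u : Ω ⊗[ZMod p] F) * (1 : Ω) ⊗ₜ c) := by
    refine hu.mul (isIntegral_of_mem_range ⟨1 ⊗ₜ c, ?_⟩)
    change extMap F _ _ = _
    rw [extMap_tmul, map_one]
  have h2 : ∀ i, IsIntegral (baseRing e x)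
      ((scalarFrob p Ω F)^[i] ((u : Ω ⊗[ZMod p] F) * (1 : Ω) ⊗ₜ c)) := by
    intro i
    induction i with
    | zero => exact h1
    | succ i ih =>
      rw [Function.iterate_succ_apply']
      exact ih.map ((scalarFrob p Ω F).restrictScalars (baseRing e x))
  have h3 : IsIntegral (baseRing e x) (∑ i ∈ Finset.range n,
      (scalarFrob p Ω F)^[i] ((u : Ω ⊗[ZMod p] F) * (1 : Ω) ⊗ₜ c)) :=
    IsIntegral.sum _ fun i _ => h2 i
  rw [hc, hx] at h3
  exact (isIntegral_algebraMap_iff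
    (FaithfulSMul.algebraMap_injective Ω (Ω ⊗[ZMod p] F))).1 h3

end BaseRing

section GeneralElement

variable {p : ℕ} [Fact p.Prime] {F : Type*} [Field F] [Algebra (ZMod p) F] {n : ℕ}
variable (e : Module.Basis (Fin n) (ZMod p) F)

/-- `K(x₁, …, x_n)` is algebraic over every subalgebra over which the indeterminates are. -/
lemma isAlgebraic_ratFuncs (T : Subalgebra (ZMod p) (RatFuncs (ZMod p) n))
    (h : ∀ k, IsAlgebraic T (indet (ZMod p) n k)) :
    Algebra.IsAlgebraic T (RatFuncs (ZMod p) n) := by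
  have hP : ∀ f : MvPolynomial (Fin n) (ZMod p),
      IsAlgebraic T (algebraMap _ (RatFuncs (ZMod p) n) f) := by
    intro f
    induction f using MvPolynomial.induction_on with
    | C c =>
      have : algebraMap (MvPolynomial (Fin n) (ZMod p)) (RatFuncs (ZMod p) n) (MvPolynomial.C c) =
          algebraMap T _ (algebraMap (ZMod p) T c) := by
        rw [← IsScalarTower.algebraMap_apply, ← MvPolynomial.algebraMap_eq,
          ← IsScalarTower.algebraMap_apply]
      rw [this]
      exact isAlgebraic_algebraMap _
    | add f g hf hg => rw [map_add]; exact hf.add hg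
    | mul_X f k hf => rw [map_mul]; exact hf.mul (h k)
  constructor
  intro y
  obtain ⟨f, g, -, rfl⟩ := IsFractionRing.div_surjective (A := MvPolynomial (Fin n) (ZMod p)) y
  rw [div_eq_mul_inv]
  exact (hP f).mul (hP g).inv

lemma algebraicIndependent_indet : AlgebraicIndependent (ZMod p) (indet (ZMod p) n) :=
  (MvPolynomial.algebraicIndependent_X (Fin n) (ZMod p)).map'
    (f := IsScalarTower.toAlgHom (ZMod p) (MvPolynomial (Fin n) (ZMod p)) (RatFuncs (ZMod p) n))
    (IsFractionRing.injective _ _)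

variable {e}

/-- The coordinates of `A` are algebraically independent: there are `n` of them, and the function
field in `n` indeterminates is algebraic over the field they generate. -/
lemma algebraicIndependent_langPoint {u : (RatFuncs (ZMod p) n ⊗[ZMod p] F)ˣ}
    (hx : coord e (u : RatFuncs (ZMod p) n ⊗[ZMod p] F) = indet (ZMod p) n) :
    AlgebraicIndependent (ZMod p)
      (coord e (langPoint u : RatFuncs (ZMod p) n ⊗[ZMod p] F)) := by
  set b := coord e (langPoint u : RatFuncs (ZMod p) n ⊗[ZMod p] F) with hb
  set A := Algebra.adjoin (ZMod p) (Set.range b) with hA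
  set T := Subalgebra.algebraicClosure A (RatFuncs (ZMod p) n) with hT
  have hle : baseRing e (indet (ZMod p) n) ≤ T.restrictScalars (ZMod p) := by
    rw [baseRing_eq_matrixAlgebra hx, matrixAlgebra, Algebra.adjoin_le_iff, Set.insert_subset_iff]
    have h1 : ∀ i j, Algebra.leftMulMatrix
        (Algebra.TensorProduct.basis (RatFuncs (ZMod p) n) e) (langPoint u) i j ∈
          T.restrictScalars (ZMod p) := by
      refine leftMulMatrix_apply_mem e _ (fun c => Subalgebra.algebraMap_mem _ c) fun k => ?_
      have hk : b k ∈ A := Algebra.subset_adjoin ⟨k, rfl⟩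
      exact isAlgebraic_algebraMap (⟨b k, hk⟩ : A)
    refine ⟨?_, ?_⟩
    · exact IsAlgebraic.inv (det_mem _ h1)
    · rintro _ ⟨i, j, rfl⟩
      exact h1 i j
  have halg : Algebra.IsAlgebraic A (RatFuncs (ZMod p) n) := by
    apply isAlgebraic_ratFuncs
    intro k
    have h1 := isIntegral_baseRing hx k
    have h2 : IsIntegral T (indet (ZMod p) n k) := by
      obtain ⟨f, hf, hf0⟩ := h1
      refine ⟨f.map ((algebraMap (baseRing e (indet (ZMod p) n)) _).codRestrict T fun r => hle r.2),
        hf.map _, ?_⟩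
      rw [Polynomial.eval₂_map]
      exact hf0
    exact h2.isAlgebraic.restrictScalars A
  refine (Algebra.IsAlgebraic.isTranscendenceBasis_of_le_trdeg_of_finite (ZMod p) b ?_).1
  exact algebraicIndependent_indet.cardinalMk_le_trdeg

end GeneralElement

/-! ### The extension `F_p[A, U^d] / F_p[A]` is Galois -/

section EvalRange

variable {K F : Type*} [Field K] [Field F] [Algebra K F] {n : ℕ}
variable (e : Module.Basis (Fin n) K F) {Ω : Type*} [Field Ω] [Algebra K Ω]

/-- If the coordinates of a unit and of its inverse lie in `T`, the unit comes from a unit of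
`T ⊗ F`. -/
lemma exists_unit_extMap_eq (e : Module.Basis (Fin n) K F) {B C : Type*} [CommRing B]
    [Algebra K B] [CommRing C] [Algebra K C] (f : B →ₐ[K] C) (hf : Function.Injective f)
    (y : (C ⊗[K] F)ˣ) (h1 : (y : C ⊗[K] F) ∈ (extMap F f).range)
    (h2 : (↑y⁻¹ : C ⊗[K] F) ∈ (extMap F f).range) :
    ∃ z : (B ⊗[K] F)ˣ, extMap F f z = y := by
  obtain ⟨z, hz⟩ := h1
  obtain ⟨z', hz'⟩ := h2
  have h3 : z * z' = 1 := by
    apply extMap_injective e f hf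
    rw [map_mul, map_one]
    exact (congrArg₂ (· * ·) hz hz').trans y.mul_inv
  exact ⟨⟨z, z', h3, by rw [mul_comm, h3]⟩, hz⟩

lemma range_evalPoint (y : (Ω ⊗[K] F)ˣ) :
    (evalPoint e y).range =
      matrixAlgebra K (Algebra.leftMulMatrix (Algebra.TensorProduct.basis Ω e) y) := by
  apply le_antisymm
  · obtain ⟨z, hz⟩ := exists_unit_extMap_eq e (matrixAlgebra K
      (Algebra.leftMulMatrix (Algebra.TensorProduct.basis Ω e) (y : Ω ⊗[K] F))).val
      Subtype.val_injective y
      (by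
        rw [mem_range_extMap e, Subalgebra.range_val]
        exact coord_mem_matrixAlgebra e y)
      (by
        rw [mem_range_extMap e, Subalgebra.range_val]
        exact coord_inv_mem_matrixAlgebra e y)
    rw [← comp_evalPoint e _ z y hz]
    rintro _ ⟨q, rfl⟩
    exact Subtype.prop _
  · rw [matrixAlgebra_le_iff, ← extMap_evalPoint e y]
    refine ⟨fun k => ⟨_, (coord_extMap e _ _ k).symm⟩, fun k => ?_⟩
    obtain ⟨t, ht⟩ := isUnit_univPoint e
    have h1 : (↑y⁻¹ : Ω ⊗[K] F) = extMap F (evalPoint e y) ↑t⁻¹ := by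
      refine (Units.eq_inv_of_mul_eq_one_right ?_).symm
      rw [← extMap_evalPoint e y, ← ht, ← map_mul, Units.inv_mul, map_one]
    rw [h1]
    exact ⟨_, (coord_extMap e _ _ k).symm⟩

end EvalRange

section TopRing

variable {p : ℕ} [Fact p.Prime] {F : Type*} [Field F] [Algebra (ZMod p) F] {n : ℕ}
variable {Ω : Type*} [Field Ω] [Algebra (ZMod p) Ω]
variable {e : Module.Basis (Fin n) (ZMod p) F} {x : Fin n → Ω} {u : (Ω ⊗[ZMod p] F)ˣ} {d : ℕ}

lemma topRing_eq_matrixAlgebra (hx : coord e (u : Ω ⊗[ZMod p] F) = x) :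
    topRing e x d = matrixAlgebra (baseRing e x)
      (Algebra.leftMulMatrix (Algebra.TensorProduct.basis Ω e) ↑(u ^ d)) := by
  rw [topRing, Units.val_pow_eq_pow_val, map_pow, leftMulMatrix_eq_resMatrix, hx]

lemma topRing_le_iff (hx : coord e (u : Ω ⊗[ZMod p] F) = x)
    (T : Subalgebra (baseRing e x) Ω) :
    topRing e x d ≤ T ↔ (∀ k, coord e (↑(u ^ d) : Ω ⊗[ZMod p] F) k ∈ T) ∧
      ∀ k, coord e (↑(u ^ d)⁻¹ : Ω ⊗[ZMod p] F) k ∈ T := by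
  rw [topRing_eq_matrixAlgebra hx, matrixAlgebra_le_iff]

/-- The inclusion of `F_p[A, U^d]` into the ambient field, as a homomorphism of
`F_p`-algebras. -/
noncomputable def topVal (e : Module.Basis (Fin n) (ZMod p) F) (x : Fin n → Ω) (d : ℕ) :
    topRing e x d →ₐ[ZMod p] Ω :=
  (topRing e x d).val.restrictScalars (ZMod p)

lemma topVal_injective : Function.Injective (topVal e x d) := Subtype.val_injective

lemma mem_range_topVal {s : Ω} : s ∈ (topVal e x d).range ↔ s ∈ topRing e x d :=
  ⟨fun ⟨t, ht⟩ => ht ▸ t.2, fun h => ⟨⟨s, h⟩, rfl⟩⟩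

/-- The point `u ^ d` of the torus is defined over `F_p[A, U^d]`. -/
lemma exists_unit_topRing (hx : coord e (u : Ω ⊗[ZMod p] F) = x) :
    ∃ z : (topRing e x d ⊗[ZMod p] F)ˣ, extMap F (topVal e x d) z = ↑(u ^ d) := by
  apply exists_unit_extMap_eq e (topVal e x d) topVal_injective (u ^ d)
  · rw [mem_range_extMap e]
    exact fun k => mem_range_topVal.2 (((topRing_le_iff hx _).1 le_rfl).1 k)
  · rw [mem_range_extMap e]
    exact fun k => mem_range_topVal.2 (((topRing_le_iff hx _).1 le_rfl).2 k)

/-- The subring of `Ω ⊗ F` generated by `F_p[A] ⊗ F` and `u ^ d`. -/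
noncomputable def kummerRing (e : Module.Basis (Fin n) (ZMod p) F) (x : Fin n → Ω)
    (u : (Ω ⊗[ZMod p] F)ˣ) (d : ℕ) : Subalgebra (extMap F (baseRing e x).val).range
      (Ω ⊗[ZMod p] F) :=
  Algebra.adjoin _ {(↑(u ^ d) : Ω ⊗[ZMod p] F)}

lemma mem_kummerRing_of_mem_range {y : Ω ⊗[ZMod p] F}
    (hy : y ∈ (extMap F (baseRing e x).val).range) : y ∈ kummerRing e x u d :=
  (kummerRing e x u d).algebraMap_mem ⟨y, hy⟩

lemma pow_mem_kummerRing : (↑(u ^ d) : Ω ⊗[ZMod p] F) ∈ kummerRing e x u d :=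
  Algebra.subset_adjoin rfl

/-- The partial Frobenius of `F` preserves the Kummer ring, because it sends `u` to
`u ^ p` times an element of `F_p[A] ⊗ F`. -/
lemma scalarFrob_mem_kummerRing (hx : coord e (u : Ω ⊗[ZMod p] F) = x) {y : Ω ⊗[ZMod p] F}
    (hy : y ∈ kummerRing e x u d) : scalarFrob p Ω F y ∈ kummerRing e x u d := by
  have hR : ∀ z ∈ (extMap F (baseRing e x).val).range,
      scalarFrob p Ω F z ∈ (extMap F (baseRing e x).val).range := by
    rintro _ ⟨z, rfl⟩
    change scalarFrob p Ω F (extMap F _ z) ∈ _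
    rw [scalarFrob_extMap]
    exact ⟨_, rfl⟩
  induction hy using Algebra.adjoin_induction with
  | mem z hz =>
    rw [Set.mem_singleton_iff.1 hz]
    have h1 := congrArg (scalarFrob p Ω F) (langPoint_mul_relFrob u)
    rw [map_mul, scalarFrob_relFrob] at h1
    rw [Units.val_pow_eq_pow_val, map_pow, ← h1, mul_pow, ← pow_mul, mul_comm p d, pow_mul,
      ← Units.val_pow_eq_pow_val]
    exact mul_mem (pow_mem (mem_kummerRing_of_mem_range (hR _ (langPoint_mem_range hx))) d)
      (pow_mem pow_mem_kummerRing p)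
  | algebraMap r => exact mem_kummerRing_of_mem_range (hR _ r.2)
  | add y z _ _ hy hz => rw [map_add]; exact add_mem hy hz
  | mul y z _ _ hy hz => rw [map_mul]; exact mul_mem hy hz

lemma coord_mem_kummerRing (hx : coord e (u : Ω ⊗[ZMod p] F) = x) {y : Ω ⊗[ZMod p] F}
    (hy : y ∈ kummerRing e x u d) (k : Fin n) :
    algebraMap Ω (Ω ⊗[ZMod p] F) (coord e y k) ∈ kummerRing e x u d := by
  obtain ⟨c, hc⟩ := sum_scalarFrob_iterate e y k
  rw [← hc]
  refine sum_mem fun i hi => ?_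
  clear hi
  induction i with
  | zero =>
    refine mul_mem hy (mem_kummerRing_of_mem_range ⟨1 ⊗ₜ c, ?_⟩)
    change extMap F _ _ = _
    rw [extMap_tmul, map_one]
  | succ i ih =>
    rw [Function.iterate_succ_apply']
    exact scalarFrob_mem_kummerRing hx ih

/-- `F_p[A, U^d]` is contained in the Kummer ring. -/
lemma topRing_le_kummerRing (hx : coord e (u : Ω ⊗[ZMod p] F) = x) {N : ℕ} (hN : N ≠ 0)
    (hd : d * N = p ^ n - 1) {s : Ω} (hs : s ∈ topRing e x d) :
    algebraMap Ω (Ω ⊗[ZMod p] F) s ∈ kummerRing e x u d := by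
  let T : Subalgebra (baseRing e x) Ω :=
    { (kummerRing e x u d).toSubring.comap (algebraMap Ω (Ω ⊗[ZMod p] F)) with
      algebraMap_mem' := fun r => mem_kummerRing_of_mem_range ⟨r ⊗ₜ 1, extMap_tmul _ _ _⟩ }
  have hT : topRing e x d ≤ T := by
    rw [topRing_le_iff hx]
    refine ⟨fun k => coord_mem_kummerRing hx pow_mem_kummerRing k,
      fun k => coord_mem_kummerRing hx ?_ k⟩
    have h1 : (↑(u ^ d)⁻¹ : Ω ⊗[ZMod p] F) =
        ↑(u ^ d) ^ (N - 1) * (↑(u ^ (p ^ n - 1))⁻¹ : Ω ⊗[ZMod p] F) := by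
      rw [← Units.val_pow_eq_pow_val, ← Units.val_mul]
      congr 1
      rw [← hd, pow_mul, eq_mul_inv_iff_mul_eq, inv_mul_eq_iff_eq_mul, ← pow_succ',
        Nat.sub_add_cancel (Nat.one_le_iff_ne_zero.2 hN)]
    rw [h1]
    exact mul_mem (pow_mem pow_mem_kummerRing _)
      (mem_kummerRing_of_mem_range (inv_pow_mem_range hx))
  exact hT hs

variable {G : Type*} [Group G] {σ : G →* (Ω →ₐ[ZMod p] Ω)} {χ : G →* Fˣ}

lemma extMap_pow_of_eigen (hσ : ∀ g, extMap F (σ g) u = ((1 : Ω) ⊗ₜ[ZMod p] (χ g : F)) * u)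
    (g : G) : extMap F (σ g) ↑(u ^ d) = ((1 : Ω) ⊗ₜ[ZMod p] ((χ g : F) ^ d)) * ↑(u ^ d) := by
  rw [Units.val_pow_eq_pow_val, map_pow, hσ, mul_pow, Algebra.TensorProduct.tmul_pow, one_pow]

/-- The group acts trivially on `F_p[A]`, because `u` and `χ(g) u` have the same image under the
Lang map. -/
lemma apply_eq_of_mem_baseRing (hx : coord e (u : Ω ⊗[ZMod p] F) = x)
    (hσ : ∀ g, extMap F (σ g) u = ((1 : Ω) ⊗ₜ[ZMod p] (χ g : F)) * u) (g : G) {r : Ω}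
    (hr : r ∈ baseRing e x) : σ g r = r := by
  have h1 : extMap F (σ g) (langPoint u : Ω ⊗[ZMod p] F) = langPoint u :=
    extMap_langPoint (σ g) u u (χ g) (hσ g)
  have h2 : extMap F (σ g) (↑(langPoint u)⁻¹ : Ω ⊗[ZMod p] F) = ↑(langPoint u)⁻¹ := by
    refine Units.eq_inv_of_mul_eq_one_right ?_
    conv_lhs => rw [← h1]
    rw [← map_mul, Units.inv_mul, map_one]
  have h3 : baseRing e x ≤ AlgHom.equalizer (σ g) (AlgHom.id (ZMod p) Ω) := by
    rw [baseRing_le_iff hx]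
    refine ⟨fun k => ?_, fun k => ?_⟩
    · rw [AlgHom.mem_equalizer, ← coord_extMap, h1]
      rfl
    · rw [AlgHom.mem_equalizer, ← coord_extMap, h2]
      rfl
  exact h3 hr

/-- The group preserves `F_p[A, U^d]`. -/
lemma apply_mem_topRing (hx : coord e (u : Ω ⊗[ZMod p] F) = x)
    (hσ : ∀ g, extMap F (σ g) u = ((1 : Ω) ⊗ₜ[ZMod p] (χ g : F)) * u) (g : G) {s : Ω}
    (hs : s ∈ topRing e x d) : σ g s ∈ topRing e x d := by
  let T : Subalgebra (baseRing e x) Ω :=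
    { (topRing e x d).toSubring.comap (σ g : Ω →+* Ω) with
      algebraMap_mem' := fun r => by
        change σ g (r : Ω) ∈ topRing e x d
        rw [apply_eq_of_mem_baseRing hx hσ g r.2]
        exact (topRing e x d).algebraMap_mem r }
  have h0 : ∀ c : F, ((1 : Ω) ⊗ₜ[ZMod p] c) ∈ (extMap F (topVal e x d)).range := fun c =>
    ⟨1 ⊗ₜ c, by change extMap F _ _ = _; rw [extMap_tmul, map_one]⟩
  obtain ⟨z, hz⟩ := exists_unit_topRing (d := d) hx
  have hz' : extMap F (topVal e x d) ↑z⁻¹ = ↑(u ^ d)⁻¹ := by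
    refine Units.eq_inv_of_mul_eq_one_right ?_
    rw [← hz, ← map_mul, Units.inv_mul, map_one]
  have hT : topRing e x d ≤ T := by
    rw [topRing_le_iff hx]
    constructor
    · have h1 : extMap F (σ g) ↑(u ^ d) ∈ (extMap F (topVal e x d)).range := by
        rw [extMap_pow_of_eigen hσ]
        exact mul_mem (h0 _) ⟨_, hz⟩
      rw [mem_range_extMap e] at h1
      intro k
      have h2 := h1 k
      rw [coord_extMap] at h2
      exact mem_range_topVal.1 h2
    · have h1 : extMap F (σ g) ↑(u ^ d)⁻¹ ∈ (extMap F (topVal e x d)).range := by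
        have h2 : extMap F (σ g) ↑(u ^ d)⁻¹ =
            ((1 : Ω) ⊗ₜ[ZMod p] ((χ g : F)⁻¹ ^ d)) * ↑(u ^ d)⁻¹ := by
          have h3 : extMap F (σ g) ↑(u ^ d)⁻¹ * extMap F (σ g) ↑(u ^ d) = 1 := by
            rw [← map_mul, Units.inv_mul, map_one]
          have h4 : ((1 : Ω) ⊗ₜ[ZMod p] ((χ g : F)⁻¹ ^ d)) *
              ((1 : Ω) ⊗ₜ[ZMod p] ((χ g : F) ^ d)) = 1 := by
            rw [Algebra.TensorProduct.tmul_mul_tmul, one_mul, ← mul_pow,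
              inv_mul_cancel₀ (Units.ne_zero _), one_pow, Algebra.TensorProduct.one_def]
          have h5 : IsUnit (extMap F (σ g) (↑(u ^ d) : Ω ⊗[ZMod p] F)) :=
            (Units.isUnit _).map _
          apply h5.mul_left_injective
          change extMap F (σ g) ↑(u ^ d)⁻¹ * extMap F (σ g) ↑(u ^ d) = _ * extMap F (σ g) ↑(u ^ d)
          rw [h3, extMap_pow_of_eigen hσ, mul_mul_mul_comm, h4, Units.inv_mul, one_mul]
        rw [h2]
        exact mul_mem (h0 _) ⟨_, hz'⟩
      rw [mem_range_extMap e] at h1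
      intro k
      have h2 := h1 k
      rw [coord_extMap] at h2
      exact mem_range_topVal.1 h2
  exact hT hs

end TopRing

section Galois

variable {p : ℕ} [Fact p.Prime] {F : Type*} [Field F] [Algebra (ZMod p) F] {n : ℕ}
variable {Ω : Type*} [Field Ω] [Algebra (ZMod p) Ω]
variable {e : Module.Basis (Fin n) (ZMod p) F} {x : Fin n → Ω} {u : (Ω ⊗[ZMod p] F)ˣ} {d : ℕ}
variable {G : Type*} [Group G] {σ : G →* (Ω →ₐ[ZMod p] Ω)} {χ : G →* Fˣ}

/-- The action of `G` on `F_p[A, U^d]` by restriction of the action on the ambient field. -/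
noncomputable abbrev topAction (hx : coord e (u : Ω ⊗[ZMod p] F) = x)
    (hσ : ∀ g, extMap F (σ g) u = ((1 : Ω) ⊗ₜ[ZMod p] (χ g : F)) * u) (d : ℕ) :
    MulSemiringAction G (topRing e x d) where
  smul g s := ⟨σ g s, apply_mem_topRing hx hσ g s.2⟩
  one_smul s := Subtype.ext (DFunLike.congr_fun (map_one σ) (s : Ω))
  mul_smul g h s := Subtype.ext (DFunLike.congr_fun (map_mul σ g h) (s : Ω))
  smul_zero g := Subtype.ext (map_zero (σ g))
  smul_add g s t := Subtype.ext (map_add (σ g) (s : Ω) t)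
  smul_one g := Subtype.ext (map_one (σ g))
  smul_mul g s t := Subtype.ext (map_mul (σ g) (s : Ω) t)

lemma extMap_eq_of_mem_range_baseRing (hx : coord e (u : Ω ⊗[ZMod p] F) = x)
    (hσ : ∀ g, extMap F (σ g) u = ((1 : Ω) ⊗ₜ[ZMod p] (χ g : F)) * u) (g : G)
    {r : Ω ⊗[ZMod p] F} (hr : r ∈ (extMap F (baseRing e x).val).range) :
    extMap F (σ g) r = r := by
  obtain ⟨z, rfl⟩ := hr
  change extMap F _ (extMap F _ z) = extMap F _ z
  rw [← extMap_comp]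
  congr 1
  congr 1
  ext r
  exact apply_eq_of_mem_baseRing hx hσ g r.2

lemma natCast_ne_zero_of_mul_eq {p : ℕ} [Fact p.Prime] {n d N : ℕ} (hn : n ≠ 0)
    (hd : d * N = p ^ n - 1) : (N : ZMod p) ≠ 0 := by
  intro h
  have h1 : p ∣ p ^ n - 1 := by
    rw [← hd]
    exact Dvd.dvd.mul_left ((ZMod.natCast_eq_zero_iff _ _).1 h) d
  have h2 := (Nat.dvd_sub_iff_right (Nat.one_le_pow n p (Fact.out : p.Prime).pos)
    (dvd_pow_self p hn)).1 h1
  exact (Fact.out : p.Prime).one_lt.ne' (Nat.dvd_one.1 h2)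

/-- If `S ⊗ F` has an invertible eigenvector for a faithful character, then only `1 ∈ G` acts
trivially modulo a maximal ideal `I`: if `g` does, comparing the eigenvector with its image under
`g` in `S/I ⊗ F` gives `χ(g) = 1`. -/
lemma exists_smul_sub_notMem {K F : Type*} [Field K] [Field F] [Algebra K F] {S : Type*}
    [CommRing S] [Algebra K S] {G : Type*} [Group G] (ρ : G →* (S →ₐ[K] S)) (χ : G →* Fˣ)
    (hχ : Function.Injective χ) (w : (S ⊗[K] F)ˣ)
    (hw : ∀ g, extMap F (ρ g) w = ((1 : S) ⊗ₜ[K] (χ g : F)) * w) (I : Ideal S) (hI : I.IsMaximal)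
    (g : G) (hg : g ≠ 1) : ∃ s : S, ρ g s - s ∉ I := by
  by_contra! hcon
  have : Nontrivial (S ⧸ I) := Ideal.Quotient.nontrivial_iff.2 hI.ne_top
  let π : S →ₐ[K] S ⧸ I := Ideal.Quotient.mkₐ K I
  have h1 : π.comp (ρ g) = π := by
    ext s
    exact Ideal.Quotient.eq.2 (hcon s)
  have h2 := congrArg (extMap F π) (hw g)
  rw [← extMap_comp, h1, map_mul, extMap_tmul, map_one] at h2
  have h3 : IsUnit (extMap F π w) := w.isUnit.map _
  have h4 : ((1 : S ⧸ I) ⊗ₜ[K] (1 : F)) = (1 : S ⧸ I) ⊗ₜ[K] (χ g : F) := by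
    apply h3.mul_left_injective
    change _ * _ = _ * _
    rw [← h2, ← Algebra.TensorProduct.one_def, one_mul]
  have h5 : (1 : F) = χ g :=
    (Algebra.TensorProduct.includeRight : F →ₐ[K] (S ⧸ I) ⊗[K] F).toRingHom.injective h4
  exact hg (hχ ((Units.val_eq_one.1 h5.symm).trans (map_one χ).symm))

/-- The action of `G` on `F_p[A, U^d]`, as a homomorphism to the monoid of algebra
endomorphisms. -/
noncomputable def topHom (hx : coord e (u : Ω ⊗[ZMod p] F) = x)
    (hσ : ∀ g, extMap F (σ g) u = ((1 : Ω) ⊗ₜ[ZMod p] (χ g : F)) * u) (d : ℕ) :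
    G →* (topRing e x d →ₐ[ZMod p] topRing e x d) where
  toFun g :=
    { (topAction hx hσ d).toRingHom G _ g with
      commutes' := fun c => Subtype.ext ((σ g).commutes c) }
  map_one' := AlgHom.ext fun s => Subtype.ext (DFunLike.congr_fun (map_one σ) (s : Ω))
  map_mul' g h := AlgHom.ext fun s => Subtype.ext (DFunLike.congr_fun (map_mul σ g h) (s : Ω))

/-- The point `u ^ d`, as a unit of `F_p[A, U^d] ⊗ F`, is an eigenvector for `χ ^ d`. -/
lemma extMap_topHom (hx : coord e (u : Ω ⊗[ZMod p] F) = x)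
    (hσ : ∀ g, extMap F (σ g) u = ((1 : Ω) ⊗ₜ[ZMod p] (χ g : F)) * u)
    {z : (topRing e x d ⊗[ZMod p] F)ˣ} (hz : extMap F (topVal e x d) z = ↑(u ^ d)) (g : G) :
    extMap F (topHom hx hσ d g) z =
      ((1 : topRing e x d) ⊗ₜ[ZMod p] (((powMonoidHom d).comp χ g : Fˣ) : F)) * z := by
  apply extMap_injective e (topVal e x d) topVal_injective
  rw [map_mul, extMap_tmul, map_one, hz, ← extMap_comp,
    show (topVal e x d).comp (topHom hx hσ d g) = (σ g).comp (topVal e x d) from rfl,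
    extMap_comp, hz, extMap_pow_of_eigen hσ]
  rfl

variable [Fintype G]

/-- Averaging over `G` maps the Kummer ring into `F_p[A] ⊗ F`: it kills the powers of `u ^ d` whose
exponent is not divisible by `|G|`. -/
lemma eigenPart_zero_mem_range (hx : coord e (u : Ω ⊗[ZMod p] F) = x)
    (hσ : ∀ g, extMap F (σ g) u = ((1 : Ω) ⊗ₜ[ZMod p] (χ g : F)) * u)
    (hd : d * Fintype.card G = p ^ n - 1) (hχ : Function.Injective fun g => χ g ^ d)
    {y : Ω ⊗[ZMod p] F} (hy : y ∈ kummerRing e x u d) :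
    eigenPart σ χ 0 y ∈ (extMap F (baseRing e x).val).range := by
  have hχ' : Function.Injective χ := fun g h hgh => hχ (by simp [hgh])
  have hcyc : IsCyclic G := isCyclic_of_injective_ringHom ((Units.coeHom F).comp χ)
    (Units.val_injective.comp hχ')
  have hc : ∀ c : F, ((1 : Ω) ⊗ₜ[ZMod p] c) ∈ (extMap F (baseRing e x).val).range := fun c =>
    ⟨1 ⊗ₜ c, by change extMap F _ _ = _; rw [extMap_tmul, map_one]⟩
  have hpow : ∀ i, eigenPart σ χ 0 ((↑(u ^ d) : Ω ⊗[ZMod p] F) ^ i) ∈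
      (extMap F (baseRing e x).val).range := by
    intro i
    have h1 : eigenPart σ χ 0 ((↑(u ^ d) : Ω ⊗[ZMod p] F) ^ i) =
        (Fintype.card G : ZMod p)⁻¹ •
          (((1 : Ω) ⊗ₜ[ZMod p] (∑ g, ((χ g : F) ^ d) ^ i)) * (↑(u ^ d) : Ω ⊗[ZMod p] F) ^ i) := by
      rw [eigenPart, TensorProduct.tmul_sum, Finset.sum_mul]
      congr 1
      refine Finset.sum_congr rfl fun g _ => ?_
      rw [pow_zero, one_mul, map_pow, extMap_pow_of_eigen hσ, mul_pow,
        Algebra.TensorProduct.tmul_pow, one_pow]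
    rw [h1]
    by_cases hi : Fintype.card G ∣ i
    · obtain ⟨l, rfl⟩ := hi
      refine Subalgebra.smul_mem _ (mul_mem (hc _) ?_) _
      have h2 : (↑(u ^ d) : Ω ⊗[ZMod p] F) ^ (Fintype.card G * l) =
          (↑(u ^ (p ^ n - 1)) : Ω ⊗[ZMod p] F) ^ l := by
        rw [← hd, pow_mul u, Units.val_pow_eq_pow_val (u ^ d), pow_mul]
      rw [h2]
      exact pow_mem (pow_mem_range hx) l
    · have h2 : ∑ g, ((χ g : F) ^ d) ^ i = 0 := by
        let f : G →* F := (Units.coeHom F).comp ((powMonoidHom i).comp ((powMonoidHom d).comp χ))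
        refine sum_hom_units_eq_zero f fun hf => hi ?_
        obtain ⟨g, hg⟩ := IsCyclic.exists_generator (α := G)
        rw [← Nat.card_eq_fintype_card, ← orderOf_eq_card_of_forall_mem_zpowers hg,
          orderOf_dvd_iff_pow_eq_one]
        apply hχ
        have h3 : f g = 1 := DFunLike.congr_fun hf g
        change χ (g ^ i) ^ d = χ 1 ^ d
        rw [map_pow, map_one, one_pow, ← pow_mul, mul_comm, pow_mul]
        exact Units.ext h3
      rw [h2, TensorProduct.tmul_zero, zero_mul, smul_zero]
      exact Subalgebra.zero_mem _
  rw [kummerRing, Algebra.adjoin_singleton_eq_range_aeval] at hy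
  obtain ⟨f, rfl⟩ := hy
  change eigenPart σ χ 0 (Polynomial.aeval _ f) ∈ _
  rw [Polynomial.aeval_eq_sum_range]
  have h1 : ∀ (s : Finset ℕ) (z : ℕ → Ω ⊗[ZMod p] F),
      eigenPart σ χ 0 (∑ i ∈ s, z i) = ∑ i ∈ s, eigenPart σ χ 0 (z i) := by
    intro s z
    simp only [eigenPart, map_sum, Finset.mul_sum, ← Finset.smul_sum]
    rw [Finset.sum_comm]
  rw [h1]
  refine sum_mem fun i _ => ?_
  have h2 : eigenPart σ χ 0 (f.coeff i • (↑(u ^ d) : Ω ⊗[ZMod p] F) ^ i) =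
      (f.coeff i : Ω ⊗[ZMod p] F) * eigenPart σ χ 0 ((↑(u ^ d) : Ω ⊗[ZMod p] F) ^ i) := by
    rw [Algebra.smul_def]
    change eigenPart σ χ 0 ((f.coeff i : Ω ⊗[ZMod p] F) * _) = _
    simp only [eigenPart, pow_zero, one_mul, map_mul,
      extMap_eq_of_mem_range_baseRing hx hσ _ (f.coeff i).2, ← Finset.mul_sum, mul_smul_comm]
  rw [h2]
  exact mul_mem (f.coeff i).2 (hpow i)

lemma mem_baseRing_of_fixed (hx : coord e (u : Ω ⊗[ZMod p] F) = x)
    (hσ : ∀ g, extMap F (σ g) u = ((1 : Ω) ⊗ₜ[ZMod p] (χ g : F)) * u)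
    (hn : n ≠ 0) (hd : d * Fintype.card G = p ^ n - 1)
    (hχ : Function.Injective fun g => χ g ^ d) {s : Ω} (hs : s ∈ topRing e x d)
    (hfix : ∀ g, σ g s = s) : s ∈ baseRing e x := by
  obtain ⟨k⟩ := e.index_nonempty
  have h1 := topRing_le_kummerRing hx Fintype.card_ne_zero hd hs
  have h2 : s ⊗ₜ[ZMod p] e k ∈ kummerRing e x u d := by
    have h3 : s ⊗ₜ[ZMod p] e k = algebraMap Ω (Ω ⊗[ZMod p] F) s * (1 : Ω) ⊗ₜ e k := by
      rw [Algebra.TensorProduct.algebraMap_apply, Algebra.algebraMap_self_apply,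
        Algebra.TensorProduct.tmul_mul_tmul, mul_one, one_mul]
    rw [h3]
    refine mul_mem h1 (mem_kummerRing_of_mem_range ⟨1 ⊗ₜ e k, ?_⟩)
    change extMap F _ _ = _
    rw [extMap_tmul, map_one]
  have h3 := eigenPart_zero_mem_range hx hσ hd hχ h2
  have h4 : eigenPart σ χ 0 (s ⊗ₜ[ZMod p] e k) = s ⊗ₜ[ZMod p] e k := by
    simp only [eigenPart, pow_zero, one_mul, extMap_tmul, hfix, Finset.sum_const,
      Finset.card_univ]
    rw [← Nat.cast_smul_eq_nsmul (ZMod p), smul_smul,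
      inv_mul_cancel₀ (natCast_ne_zero_of_mul_eq hn hd), one_smul]
  rw [h4, mem_range_extMap e] at h3
  have h5 := h3 k
  rwa [coord_tmul_basis, Subalgebra.range_val] at h5

theorem isGaloisRingExtension_topRing (hx : coord e (u : Ω ⊗[ZMod p] F) = x)
    (hσ : ∀ g, extMap F (σ g) u = ((1 : Ω) ⊗ₜ[ZMod p] (χ g : F)) * u)
    (hn : n ≠ 0) (hd : d * Fintype.card G = p ^ n - 1)
    (hχ : Function.Injective fun g => χ g ^ d) :
    letI := topAction hx hσ d
    IsGaloisRingExtension G (baseRing e x) (topRing e x d) := by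
  let _ := topAction hx hσ d
  exact
    { finite := inferInstance
      injective := fun r s h => Subtype.ext (congrArg (topRing e x d).val h)
      smul_algebraMap := fun g r => Subtype.ext (apply_eq_of_mem_baseRing hx hσ g r.2)
      exists_of_fixed := fun s hs =>
        ⟨⟨s, mem_baseRing_of_fixed hx hσ hn hd hχ s.2 fun g => congrArg Subtype.val (hs g)⟩,
          Subtype.ext rfl⟩
      free := fun I hI g hg => by
        obtain ⟨z, hz⟩ := exists_unit_topRing (d := d) hx
        exact exists_smul_sub_notMem (topHom hx hσ d) ((powMonoidHom d).comp χ) hχ z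
          (extMap_topHom hx hσ hz) I hI g hg }

end Galois

/-! ### The generic point of the torus -/

section GenericPoint

variable {K F : Type*} [Field K] [Field F] [Algebra K F] {n : ℕ}
variable (e : Module.Basis (Fin n) K F)

lemma resMatrix_indet_det_ne_zero : (resMatrix e (indet K n)).det ≠ 0 := by
  have h := map_torusDet e (IsScalarTower.toAlgHom K (MvPolynomial (Fin n) K) (RatFuncs K n))
  have h1 : (resMatrix e (indet K n)).det =
      algebraMap (MvPolynomial (Fin n) K) (RatFuncs K n) (torusDet e) := h.symm
  rw [h1]
  exact (map_ne_zero_iff _ (IsFractionRing.injective _ _)).2 (torusDet_ne_zero e)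

/-- The generic point of the torus, defined over the function field. -/
noncomputable def torusPoint : (RatFuncs K n ⊗[K] F)ˣ :=
  ((isUnit_iff_isUnit_det e (ofCoord e (indet K n))).2 (by
    rw [← resMatrix_eq_leftMulMatrix]
    exact (resMatrix_indet_det_ne_zero e).isUnit)).unit

lemma coord_torusPoint : coord e (torusPoint e : RatFuncs K n ⊗[K] F) = indet K n :=
  coord_ofCoord e (indet K n)

/-- A homomorphism out of `K(x₁, …, x_n)` is determined by the image of the generic point. -/
lemma ratFuncs_hom_ext {B : Type*} [CommRing B] [Algebra K B] {f g : RatFuncs K n →ₐ[K] B}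
    (h : extMap F f (torusPoint e) = extMap F g (torusPoint e)) : f = g := by
  refine IsLocalization.algHom_ext (nonZeroDivisors (MvPolynomial (Fin n) K))
    (MvPolynomial.algHom_ext ?_)
  intro k
  have h1 := congrFun (congrArg (coord e) h) k
  rwa [coord_extMap, coord_extMap, coord_torusPoint] at h1

lemma evalPoint_torusPoint_injective : Function.Injective (evalPoint e (torusPoint e)) := by
  apply evalPoint_injective
  rw [coord_torusPoint]
  exact (MvPolynomial.algebraicIndependent_X (Fin n) K).map'
    (f := IsScalarTower.toAlgHom K (MvPolynomial (Fin n) K) (RatFuncs K n))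
    (IsFractionRing.injective _ _)

/-- Every scalar `c ∈ F` induces a linear substitution on polynomials, corresponding to
multiplication by `c` on the torus. -/
noncomputable def scalarSubst (c : F) : MvPolynomial (Fin n) K →ₐ[K] MvPolynomial (Fin n) K :=
  MvPolynomial.aeval (coord e ((1 ⊗ₜ c) * ofCoord e MvPolynomial.X))

lemma extMap_scalarSubst (c : F) :
    extMap F (scalarSubst e c) (ofCoord e MvPolynomial.X) =
      (1 ⊗ₜ c) * ofCoord e (MvPolynomial.X : Fin n → MvPolynomial (Fin n) K) := by
  rw [extMap_ofCoord]
  simp [scalarSubst]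

lemma mvPolynomial_hom_ext {B : Type*} [CommRing B] [Algebra K B]
    {f g : MvPolynomial (Fin n) K →ₐ[K] B}
    (h : extMap F f (ofCoord e MvPolynomial.X) = extMap F g (ofCoord e MvPolynomial.X)) :
    f = g := by
  refine MvPolynomial.algHom_ext fun k => ?_
  have h1 := congrFun (congrArg (coord e) h) k
  rwa [coord_extMap, coord_extMap, coord_ofCoord] at h1

lemma scalarSubst_injective {c : F} (hc : c ≠ 0) : Function.Injective (scalarSubst e c) := by
  have h : (scalarSubst e c⁻¹).comp (scalarSubst e c) = AlgHom.id K _ := by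
    apply mvPolynomial_hom_ext e
    rw [extMap_comp, extMap_scalarSubst, map_mul, extMap_scalarSubst, extMap_tmul, map_one,
      extMap_id, ← mul_assoc, Algebra.TensorProduct.tmul_mul_tmul, mul_one, mul_inv_cancel₀ hc,
      ← Algebra.TensorProduct.one_def, one_mul]
  exact Function.LeftInverse.injective (g := scalarSubst e c⁻¹) (DFunLike.congr_fun h)

lemma algebraMap_scalarSubst_injective (c : Fˣ) : Function.Injective
    ((IsScalarTower.toAlgHom K (MvPolynomial (Fin n) K) (RatFuncs K n)).comp
      (scalarSubst e (c : F))) :=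
  Function.Injective.comp (g := algebraMap (MvPolynomial (Fin n) K) (RatFuncs K n))
    (IsFractionRing.injective _ _) (scalarSubst_injective e c.ne_zero)

/-- Multiplication by `c ∈ Fˣ` on the torus, as an endomorphism of its function field. -/
noncomputable def scalarHom (c : Fˣ) : RatFuncs K n →ₐ[K] RatFuncs K n :=
  IsFractionRing.liftAlgHom (A := MvPolynomial (Fin n) K)
    (g := (IsScalarTower.toAlgHom K (MvPolynomial (Fin n) K) (RatFuncs K n)).comp
      (scalarSubst e c))
    (algebraMap_scalarSubst_injective e c)

lemma scalarHom_algebraMap (c : Fˣ) (f : MvPolynomial (Fin n) K) :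
    scalarHom e c (algebraMap (MvPolynomial (Fin n) K) (RatFuncs K n) f) =
      algebraMap (MvPolynomial (Fin n) K) (RatFuncs K n) (scalarSubst e c f) := by
  rw [scalarHom, IsFractionRing.liftAlgHom_apply]
  exact IsFractionRing.lift_algebraMap (algebraMap_scalarSubst_injective e c) f

lemma extMap_scalarHom (c : Fˣ) :
    extMap F (scalarHom e c) (torusPoint e) =
      ((1 : RatFuncs K n) ⊗ₜ[K] (c : F)) * torusPoint e := by
  set ι := IsScalarTower.toAlgHom K (MvPolynomial (Fin n) K) (RatFuncs K n) with hι
  have h1 : (torusPoint e : RatFuncs K n ⊗[K] F) = extMap F ι (ofCoord e MvPolynomial.X) :=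
    (extMap_ofCoord e ι _).symm
  have h2 : (scalarHom e c).comp ι = ι.comp (scalarSubst e c) := by
    exact AlgHom.ext (scalarHom_algebraMap e c)
  rw [h1, ← extMap_comp, h2, extMap_comp, extMap_scalarSubst, map_mul, extMap_tmul, map_one]

/-- The action of `G` on the function field of the torus through the character `χ`. -/
noncomputable def torusAction {G : Type*} [Group G] (χ : G →* Fˣ) :
    G →* (RatFuncs K n →ₐ[K] RatFuncs K n) where
  toFun g := scalarHom e (χ g)
  map_one' := by
    apply ratFuncs_hom_ext e
    rw [extMap_scalarHom, map_one, Units.val_one, ← Algebra.TensorProduct.one_def, one_mul]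
    exact (extMap_id _).symm
  map_mul' g h := by
    apply ratFuncs_hom_ext e
    refine Eq.trans ?_ (extMap_comp _ _ _).symm
    rw [extMap_scalarHom, extMap_scalarHom, map_mul (extMap F _), extMap_scalarHom, extMap_tmul,
      map_one, ← mul_assoc, Algebra.TensorProduct.tmul_mul_tmul, mul_one, map_mul, Units.val_mul,
      mul_comm (χ g : F)]

lemma extMap_torusAction {G : Type*} [Group G] (χ : G →* Fˣ) (g : G) :
    extMap F (torusAction e χ g) (torusPoint e) =
      ((1 : RatFuncs K n) ⊗ₜ[K] (χ g : F)) * torusPoint e :=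
  extMap_scalarHom e (χ g)

end GenericPoint

/-! ### Specializations -/

section BaseChange

variable {K F : Type*} [Field K] [Field F] [Algebra K F] {n : ℕ}

/-- An equivariant homomorphism `ψ` from a Galois extension `S/R` to a Galois algebra `M/L`
identifies `M` with the base change of `S`, provided that `S ⊗ F` contains an invertible
eigenvector for a faithful character. -/
lemma specializesTo_of_equivariant (e : Module.Basis (Fin n) K F) {G R S L M : Type*} [Group G]
    [Fintype G] [CommRing R] [Algebra K R] [CommRing S] [Algebra K S] [Algebra R S]
    [IsScalarTower K R S] [MulSemiringAction G S] [Field L] [Algebra K L] [CommRing M]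
    [Algebra K M] [Algebra L M] [IsScalarTower K L M] [MulSemiringAction G M]
    (hS : IsGaloisRingExtension G R S) (hM : IsGaloisRingExtension G L M)
    (ρ : G →* (S →ₐ[K] S)) (hρ : ∀ (g : G) s, ρ g s = g • s)
    (ρ' : G →* (M →ₐ[K] M)) (hρ' : ∀ (g : G) s, ρ' g s = g • s)
    (φ : R →ₐ[K] L) (ψ : S →ₐ[K] M) (hφψ : ∀ r, ψ (algebraMap R S r) = algebraMap L M (φ r))
    (hψ : ∀ (g : G) s, ψ (g • s) = g • ψ s) (χ : G →* Fˣ) (hχ : Function.Injective χ)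
    (hN : (Fintype.card G : K) ≠ 0) (z : (S ⊗[K] F)ˣ)
    (hz : ∀ g, extMap F (ρ g) z = ((1 : S) ⊗ₜ[K] (χ g : F)) * z) :
    SpecializesTo G S M (φ : R →+* L) := by
  let _ : Algebra R L := (φ : R →+* L).toAlgebra
  let _ : Algebra R M := ((algebraMap L M).comp (φ : R →+* L)).toAlgebra
  have : IsScalarTower R L M := IsScalarTower.of_algebraMap_eq' rfl
  have : IsScalarTower K R L := IsScalarTower.of_algebraMap_eq' φ.comp_algebraMap.symm
  let ψR : S →ₐ[R] M := { ψ with commutes' := hφψ }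
  let ρR : ∀ g, S →ₐ[R] S := fun g =>
    { ρ g with commutes' := fun r => (hρ g _).trans (hS.smul_algebraMap g r) }
  let ρB : G →* (L ⊗[R] S →ₐ[K] L ⊗[R] S) :=
    { toFun := fun g => (Algebra.TensorProduct.map (AlgHom.id L L) (ρR g)).restrictScalars K
      map_one' := by
        ext b
        induction b with
        | zero => simp
        | tmul l s =>
          change l ⊗ₜ[R] (ρ 1 s) = l ⊗ₜ[R] s
          rw [map_one]
          rfl
        | add b c hb hc => rw [map_add, map_add, hb, hc]
      map_mul' := fun g h => by
        ext b
        induction b with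
        | zero => simp
        | tmul l s =>
          change l ⊗ₜ[R] (ρ (g * h) s) = l ⊗ₜ[R] (ρ g (ρ h s))
          rw [map_mul]
          rfl
        | add b c hb hc => rw [map_add, map_add, hb, hc] }
  have hρB : ∀ g l s, ρB g (l ⊗ₜ[R] s) = l ⊗ₜ[R] (g • s) := fun g l s => by
    rw [← hρ]
    rfl
  let iB : L →ₐ[K] L ⊗[R] S := 
    (Algebra.TensorProduct.includeLeft : L →ₐ[L] L ⊗[R] S).restrictScalars K
  let iM : L →ₐ[K] M := IsScalarTower.toAlgHom K L M
  let Θ : L ⊗[R] S →ₐ[L] M :=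
    Algebra.TensorProduct.lift (Algebra.ofId L M) ψR fun _ _ => Commute.all _ _
  have hΘ : ∀ l s, Θ (l ⊗ₜ[R] s) = algebraMap L M l * ψ s := fun l s =>
    Algebra.TensorProduct.lift_tmul ..
  have hΘg : ∀ g l s, Θ (l ⊗ₜ[R] (g • s)) = g • Θ (l ⊗ₜ[R] s) := fun g l s => by
    rw [hΘ, hΘ, hψ, smul_mul', hM.smul_algebraMap]
  -- traces in `L ⊗ S` come from `L`
  have htr : ∀ b, ∑ g, ρB g b ∈ iB.range := by
    intro b
    induction b with
    | zero => simp
    | tmul l s =>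
      obtain ⟨r, hr⟩ := hS.exists_of_fixed (∑ g : G, g • s) fun h => by
        rw [Finset.smul_sum]
        exact Fintype.sum_equiv (Equiv.mulLeft h) _ _ fun g => by simp [mul_smul]
      simp only [hρB]
      rw [← TensorProduct.tmul_sum, ← hr, Algebra.algebraMap_eq_smul_one, TensorProduct.tmul_smul,
        TensorProduct.smul_tmul']
      exact ⟨r • l, rfl⟩
    | add b c hb hc =>
      simp only [map_add, Finset.sum_add_distrib]
      exact add_mem hb hc
  have hfixB : ∀ b, (∀ g, ρB g b = b) → b ∈ iB.range := by
    intro b hb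
    have h1 := htr b
    simp only [hb, Finset.sum_const, Finset.card_univ] at h1
    have h2 := Subalgebra.smul_mem _ h1 (Fintype.card G : K)⁻¹
    rwa [← Nat.cast_smul_eq_nsmul K, smul_smul, inv_mul_cancel₀ hN, one_smul] at h2
  let inc : S →ₐ[K] L ⊗[R] S :=
    (Algebra.TensorProduct.includeRight : S →ₐ[R] L ⊗[R] S).restrictScalars K
  have hbij : Function.Bijective (Θ.restrictScalars K) := by
    refine bijective_of_equivariant e ρB ρ' χ hχ hN iB iM hfixB
      (fun c hc => ?_) hM.injective (Θ.restrictScalars K) (fun g => ?_) ?_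
      (Units.map (extMap F inc : S ⊗[K] F →* (L ⊗[R] S) ⊗[K] F) z) (fun g => ?_)
    · obtain ⟨l, hl⟩ := hM.exists_of_fixed c fun g => (hρ' g c).symm.trans (hc g)
      exact ⟨l, hl⟩
    · ext b
      change Θ (ρB g b) = ρ' g (Θ b)
      induction b with
      | zero => simp
      | tmul l s => rw [hρB, hΘg, hρ']
      | add b c hb hc => rw [map_add, map_add, map_add, map_add, hb, hc]
    · ext l
      change Θ (l ⊗ₜ[R] 1) = algebraMap L M l
      rw [hΘ, map_one, mul_one]
    · change extMap F (ρB g) (extMap F inc z) = _ * extMap F inc z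
      have h1 : (ρB g).comp inc = inc.comp (ρ g) := by
        ext s
        change ρB g (1 ⊗ₜ[R] s) = 1 ⊗ₜ[R] (ρ g s)
        rw [hρB, hρ]
      rw [← extMap_comp, h1, extMap_comp, hz, map_mul, extMap_tmul, map_one]
  exact ⟨AlgEquiv.ofBijective Θ hbij, hΘg⟩

end BaseChange

section Specialization

variable {p : ℕ} [Fact p.Prime] {F : Type*} [Field F] [Algebra (ZMod p) F] {n : ℕ}
variable (e : Module.Basis (Fin n) (ZMod p) F)

lemma evalPoint_langPoint_injective : Function.Injective (evalPoint e (langPoint (torusPoint e))) :=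
  evalPoint_injective e _ (algebraicIndependent_langPoint (coord_torusPoint e))

lemma range_evalPoint_langPoint :
    (evalPoint e (langPoint (torusPoint e))).range = baseRing e (indet (ZMod p) n) := by
  rw [range_evalPoint, baseRing_eq_matrixAlgebra (coord_torusPoint e)]

/-- `F_p[A]` is isomorphic to the coordinate ring of the torus, with `A` corresponding to the
universal point. -/
noncomputable def baseRingEquiv : TorusRing e ≃ₐ[ZMod p] baseRing e (indet (ZMod p) n) :=
  (AlgEquiv.ofInjective _ (evalPoint_langPoint_injective e)).trans
    (Subalgebra.equivOfEq _ _ (range_evalPoint_langPoint e))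

lemma isLocalizedPolynomialRing_baseRing :
    IsLocalizedPolynomialRing (ZMod p) (baseRing e (indet (ZMod p) n)) :=
  ⟨n, torusDet e, torusDet_ne_zero e, ⟨(baseRingEquiv e).symm⟩⟩

/-- The universal point, as a unit. -/
noncomputable def univUnit {K F : Type*} [Field K] [Field F] [Algebra K F] {n : ℕ}
    (e : Module.Basis (Fin n) K F) : (TorusRing e ⊗[K] F)ˣ :=
  (isUnit_univPoint e).unit

lemma extMap_evalPoint_univUnit {K F : Type*} [Field K] [Field F] [Algebra K F] {n : ℕ}
    (e : Module.Basis (Fin n) K F) {B : Type*} [CommRing B] [Algebra K B] (y : (B ⊗[K] F)ˣ) :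
    extMap F (evalPoint e y) (univUnit e) = y :=
  extMap_evalPoint e y

lemma extMap_inv {K F : Type*} [Field K] [Field F] [Algebra K F] {B C : Type*} [CommRing B]
    [Algebra K B] [CommRing C] [Algebra K C] (f : B →ₐ[K] C) {y : (B ⊗[K] F)ˣ}
    {z : (C ⊗[K] F)ˣ} (h : extMap F f y = z) : extMap F f ↑y⁻¹ = ↑z⁻¹ := by
  refine Units.eq_inv_of_mul_eq_one_right ?_
  rw [← h, ← map_mul, Units.inv_mul, map_one]

lemma extMap_evalPoint_langPoint {B : Type*} [CommRing B] [Algebra (ZMod p) B]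
    (y : (B ⊗[ZMod p] F)ˣ) :
    extMap F (evalPoint e y) (langPoint (univUnit e)) = langPoint y :=
  extMap_langPoint _ _ _ 1 (by
    rw [extMap_evalPoint_univUnit, ← Algebra.TensorProduct.one_def, one_mul])

/-- `F_p[A, U^d]` is contained in the coordinate ring of the torus of `U`. -/
lemma topRing_le_range_evalPoint (d : ℕ) {s : RatFuncs (ZMod p) n}
    (hs : s ∈ topRing e (indet (ZMod p) n) d) : s ∈ (evalPoint e (torusPoint e)).range := by
  set j := evalPoint e (torusPoint e) with hj
  have hmem : ∀ (y : TorusRing e ⊗[ZMod p] F) (k : Fin n),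
      coord e (extMap F j y) k ∈ j.range := fun y k => ⟨_, (coord_extMap e j y k).symm⟩
  have hbase : baseRing e (indet (ZMod p) n) ≤ j.range := by
    rw [baseRing_le_iff (coord_torusPoint e)]
    have h1 := extMap_evalPoint_langPoint e (torusPoint e)
    rw [← extMap_inv _ h1, ← h1]
    exact ⟨hmem _, hmem _⟩
  let T : Subalgebra (baseRing e (indet (ZMod p) n)) (RatFuncs (ZMod p) n) :=
    { j.range.toSubring with algebraMap_mem' := fun r => hbase r.2 }
  have hT : topRing e (indet (ZMod p) n) d ≤ T := by
    rw [topRing_le_iff (coord_torusPoint e)]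
    have h1 : extMap F j ↑(univUnit e ^ d) = ↑(torusPoint e ^ d) := by
      rw [Units.val_pow_eq_pow_val, map_pow, extMap_evalPoint_univUnit, Units.val_pow_eq_pow_val]
    rw [← extMap_inv _ h1, ← h1]
    exact ⟨hmem _, hmem _⟩
  exact hT hs

/-- The homomorphism from `F_p[A, U^d]` that sends `U` to a given point of the torus. -/
noncomputable def topEval (d : ℕ) {B : Type*} [CommRing B] [Algebra (ZMod p) B]
    (y : (B ⊗[ZMod p] F)ˣ) : topRing e (indet (ZMod p) n) d →ₐ[ZMod p] B :=
  (evalPoint e y).comp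
    ((AlgEquiv.ofInjective _ (evalPoint_torusPoint_injective e)).symm.toAlgHom.comp
      ((topVal e (indet (ZMod p) n) d).codRestrict _
        fun s => topRing_le_range_evalPoint e d s.2))

lemma topEval_eq (d : ℕ) {B : Type*} [CommRing B] [Algebra (ZMod p) B]
    (y : (B ⊗[ZMod p] F)ˣ) (s : topRing e (indet (ZMod p) n) d) (q : TorusRing e)
    (h : evalPoint e (torusPoint e) q = s) : topEval e d y s = evalPoint e y q := by
  change evalPoint e y ((AlgEquiv.ofInjective _ (evalPoint_torusPoint_injective e)).symm _) = _
  congr 1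
  rw [AlgEquiv.symm_apply_eq]
  exact Subtype.ext h.symm

/-- The action of a group on a Galois algebra, as a homomorphism to the monoid of algebra
endomorphisms. -/
noncomputable def galoisHom {G K L M : Type*} [Group G] [CommRing K] [CommRing L] [Algebra K L]
    [CommRing M] [Algebra K M] [Algebra L M] [IsScalarTower K L M] [MulSemiringAction G M]
    (hM : IsGaloisRingExtension G L M) : G →* (M →ₐ[K] M) where
  toFun g :=
    { MulSemiringAction.toRingHom G M g with
      commutes' := fun c => by
        rw [IsScalarTower.algebraMap_apply K L M]
        exact hM.smul_algebraMap g _ }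
  map_one' := AlgHom.ext fun s => one_smul G s
  map_mul' g h := AlgHom.ext fun s => mul_smul g h s

/-- A nonzero element of `F`, as a point of the torus over `B`. -/
noncomputable def scalarUnit {K F : Type*} [Field K] [Field F] [Algebra K F] (B : Type*)
    [CommRing B] [Algebra K B] (c : Fˣ) : (B ⊗[K] F)ˣ :=
  Units.map (Algebra.TensorProduct.includeRight : F →ₐ[K] B ⊗[K] F) c

lemma extMap_evalPoint_scalarUnit {K F : Type*} [Field K] [Field F] [Algebra K F] {n : ℕ}
    (e : Module.Basis (Fin n) K F) {B : Type*} [CommRing B] [Algebra K B] (c : Fˣ)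
    (y : (B ⊗[K] F)ˣ) :
    extMap F (evalPoint e y) ↑(scalarUnit (TorusRing e) c * univUnit e : (TorusRing e ⊗[K] F)ˣ) =
      ((scalarUnit B c * y : (B ⊗[K] F)ˣ) : B ⊗[K] F) := by
  rw [Units.val_mul, map_mul, extMap_evalPoint_univUnit]
  change extMap F (evalPoint e y) ((1 : TorusRing e) ⊗ₜ[K] (c : F)) * y =
    ((1 : B) ⊗ₜ[K] (c : F)) * y
  rw [extMap_tmul, map_one]

/-- Every Galois `G`-algebra `M/L` is a specialization: a unit `v` of `M ⊗ F` with `g v = χ(g) v`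
gives a homomorphism from `F_p[A, U^d]` to `M` by `U ↦ v`, which sends `F_p[A]` to `L`. -/
theorem exists_specializesTo {G : Type*} [Group G] [Fintype G] (χ : G →* Fˣ) {m d : ℕ}
    (hm : m ≠ 0) (hG : Fintype.card G = 2 ^ m) (hp : p ≠ 2)
    (hd : d * Fintype.card G = p ^ n - 1) (hχ : Function.Injective fun g => χ g ^ d)
    (L : Type*) [Field L] [Algebra (ZMod p) L] (M : Type*) [CommRing M] [Algebra L M]
    [MulSemiringAction G M] (hM : IsGaloisRingExtension G L M) :
    letI := topAction (coord_torusPoint e) (extMap_torusAction e χ) d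
    ∃ φ : baseRing e (indet (ZMod p) n) →ₐ[ZMod p] L,
      SpecializesTo G (topRing e (indet (ZMod p) n) d) M
        (φ : baseRing e (indet (ZMod p) n) →+* L) := by
  let _ := topAction (coord_torusPoint e) (extMap_torusAction e χ) d
  let _ : Algebra (ZMod p) M := ((algebraMap L M).comp (algebraMap (ZMod p) L)).toAlgebra
  have : IsScalarTower (ZMod p) L M := IsScalarTower.of_algebraMap_eq' rfl
  have hn : n ≠ 0 := by
    rintro rfl
    exact e.index_nonempty.elim fun i => i.elim0
  have h2 : (2 : ZMod p) ≠ 0 := by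
    intro h
    have h1 : ((2 : ℕ) : ZMod p) = 0 := by exact_mod_cast h
    rw [ZMod.natCast_eq_zero_iff] at h1
    exact hp ((Nat.prime_dvd_prime_iff_eq Fact.out Nat.prime_two).1 h1)
  have hχ' : Function.Injective χ := fun g h hgh => hχ (by simp [hgh])
  let i : L →ₐ[ZMod p] M := IsScalarTower.toAlgHom (ZMod p) L M
  let ρ : G →* (M →ₐ[ZMod p] M) := galoisHom hM
  have hfix : ∀ b, (∀ g, ρ g b = b) → b ∈ i.range := fun b hb => by
    obtain ⟨l, hl⟩ := hM.exists_of_fixed b hb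
    exact ⟨l, hl⟩
  obtain ⟨v, hv⟩ := exists_unit_eigenvector e ρ χ hχ' hm hG h2 i hM.injective
    hM.smul_algebraMap hfix hM.free
  -- the image of `v` under the Lang map is fixed by `G`, hence defined over `L`
  have ha : ∀ g, extMap F (ρ g) (langPoint v) = langPoint v := fun g =>
    extMap_langPoint (ρ g) v v (χ g) (hv g)
  obtain ⟨a, ha⟩ := exists_unit_extMap_eq e i hM.injective (langPoint v)
    (mem_range_extMap_of_fixed e ρ i hfix ha)
    (mem_range_extMap_of_fixed e ρ i hfix fun g => extMap_inv _ (ha g))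
  refine ⟨(evalPoint e a).comp (baseRingEquiv e).symm.toAlgHom, ?_⟩
  obtain ⟨z, hz⟩ := exists_unit_topRing (d := d) (coord_torusPoint e)
  refine specializesTo_of_equivariant e
    (isGaloisRingExtension_topRing (coord_torusPoint e) (extMap_torusAction e χ) hn hd hχ) hM
    (topHom (coord_torusPoint e) (extMap_torusAction e χ) d) (fun _ _ => rfl)
    ρ (fun _ _ => rfl) _ (topEval e d v) ?_ ?_ ((powMonoidHom d).comp χ) hχ
    (natCast_ne_zero_of_mul_eq hn hd) z
    (extMap_topHom (coord_torusPoint e) (extMap_torusAction e χ) hz)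
  · intro r
    obtain ⟨q, rfl⟩ := (baseRingEquiv e).surjective r
    change _ = algebraMap L M (evalPoint e a ((baseRingEquiv e).symm _))
    rw [AlgEquiv.symm_apply_apply]
    have h3 : (evalPoint e (torusPoint e)).comp (evalPoint e (langPoint (univUnit e))) =
        evalPoint e (langPoint (torusPoint e)) :=
      comp_evalPoint e _ _ _ (extMap_evalPoint_langPoint e _)
    rw [topEval_eq e d v (algebraMap _ _ (baseRingEquiv e q))
      (evalPoint e (langPoint (univUnit e)) q) (DFunLike.congr_fun h3 q)]
    have h4 : (evalPoint e v).comp (evalPoint e (langPoint (univUnit e))) =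
        i.comp (evalPoint e a) := by
      rw [comp_evalPoint e _ _ _ (extMap_evalPoint_langPoint e v), comp_evalPoint e _ _ _ ha]
    exact DFunLike.congr_fun h4 q
  · intro g s
    obtain ⟨q, hq⟩ := topRing_le_range_evalPoint e d s.2
    change evalPoint e (torusPoint e) q = s at hq
    have h3 : (torusAction e χ g).comp (evalPoint e (torusPoint e)) =
        (evalPoint e (torusPoint e)).comp
          (evalPoint e (scalarUnit (TorusRing e) (χ g) * univUnit e)) := by
      rw [comp_evalPoint e _ _ (scalarUnit _ (χ g) * torusPoint e) (extMap_torusAction e χ g),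
        comp_evalPoint e _ _ _ (extMap_evalPoint_scalarUnit e (χ g) (torusPoint e))]
    have h4 : (ρ g).comp (evalPoint e v) =
        (evalPoint e v).comp (evalPoint e (scalarUnit (TorusRing e) (χ g) * univUnit e)) := by
      rw [comp_evalPoint e _ _ (scalarUnit _ (χ g) * v) (hv g),
        comp_evalPoint e _ _ _ (extMap_evalPoint_scalarUnit e (χ g) v)]
    rw [topEval_eq e d v s q hq]
    refine (topEval_eq e d v _ _ ?_).trans (DFunLike.congr_fun h4 q).symm
    refine (DFunLike.congr_fun h3 q).symm.trans ?_
    exact congrArg (torusAction e χ g) hq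

end Specialization

/-! ### The generic extension -/

section Main

/-- The multiplicative group of a finite field contains every cyclic group whose order divides its
own. -/
lemma exists_injective_character {F : Type*} [Field F] [Finite F] {N : ℕ} [NeZero N]
    (h : N ∣ Nat.card Fˣ) :
    ∃ χ : Multiplicative (ZMod N) →* Fˣ, Function.Injective χ := by
  obtain ⟨c, hc⟩ := h
  obtain ⟨g, hg⟩ := IsCyclic.exists_generator (α := Fˣ)
  have hc0 : c ≠ 0 := by
    rintro rfl
    rw [mul_zero] at hc
    exact Nat.card_pos.ne' hc
  have h1 : orderOf (g ^ c) = N := by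
    rw [orderOf_pow' g hc0, orderOf_eq_card_of_forall_mem_zpowers hg, hc,
      Nat.gcd_eq_right (Dvd.intro_left N rfl), Nat.mul_div_cancel _ (Nat.pos_of_ne_zero hc0)]
  have h2 : Nat.card (Multiplicative (ZMod N)) = Nat.card (Subgroup.zpowers (g ^ c)) := by
    rw [Nat.card_zpowers, h1]
    exact Nat.card_zmod N
  exact ⟨(Subgroup.subtype _).comp (mulEquivOfCyclicCardEq h2).toMonoidHom,
    Subtype.val_injective.comp (mulEquivOfCyclicCardEq h2).injective⟩

variable {p : ℕ} [Fact p.Prime] {F : Type*} [Field F] [Algebra (ZMod p) F] {n : ℕ}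
variable (e : Module.Basis (Fin n) (ZMod p) F) {G : Type*} [Group G] (χ : G →* Fˣ)

/-- The embedding of `G` in the group of `F_p`-points of the torus given by a character. -/
noncomputable def torusEmbedding : G →* GL (Fin n) (ZMod p) :=
  (Units.map (Algebra.leftMulMatrix e : F →* Matrix (Fin n) (Fin n) (ZMod p))).comp χ

lemma torusEmbedding_injective (hχ : Function.Injective χ) :
    Function.Injective (torusEmbedding e χ) :=
  (Units.map_injective (Algebra.leftMulMatrix_injective e)).comp hχ

lemma torusEmbedding_mem (g : G) : torusEmbedding e χ g ∈ resTorus e (ZMod p) := by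
  refine ⟨e.repr (χ g), ?_⟩
  change Algebra.leftMulMatrix e (χ g : F) = _
  conv_lhs => rw [← e.sum_repr (χ g : F), map_sum]
  refine Finset.sum_congr rfl fun k _ => ?_
  rw [map_smul]
  rfl

/-- The action of `G` on the entries of `U ^ d` is the one induced by `U ↦ U · ι(g)`. -/
lemma torusAction_pow_apply (g : G) (d : ℕ) (i j : Fin n) :
    torusAction e χ g ((resMatrix e (indet (ZMod p) n) ^ d) i j) =
      ((resMatrix e (indet (ZMod p) n) *
        (torusEmbedding e χ g : Matrix (Fin n) (Fin n) (ZMod p)).map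
          (algebraMap (ZMod p) (RatFuncs (ZMod p) n))) ^ d) i j := by
  have h1 : (torusEmbedding e χ g : Matrix (Fin n) (Fin n) (ZMod p)).map
      (algebraMap (ZMod p) (RatFuncs (ZMod p) n)) =
      Algebra.leftMulMatrix (Algebra.TensorProduct.basis (RatFuncs (ZMod p) n) e)
        ((1 : RatFuncs (ZMod p) n) ⊗ₜ (χ g : F)) := (leftMulMatrix_tmul e _).symm
  have h2 : resMatrix e (indet (ZMod p) n) =
      Algebra.leftMulMatrix (Algebra.TensorProduct.basis (RatFuncs (ZMod p) n) e)
        (torusPoint e) := by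
    rw [leftMulMatrix_eq_resMatrix, coord_torusPoint]
  have h3 : (torusPoint e : RatFuncs (ZMod p) n ⊗[ZMod p] F) *
      ((1 : RatFuncs (ZMod p) n) ⊗ₜ (χ g : F)) = extMap F (torusAction e χ g) (torusPoint e) := by
    rw [extMap_torusAction, mul_comm]
  rw [h1, h2, ← map_mul, ← map_pow, ← map_pow, h3, ← map_pow, leftMulMatrix_extMap]
  rfl

theorem isGenericExtension_topRing [Fintype G] {m d : ℕ} (hm : m ≠ 0)
    (hG : Fintype.card G = 2 ^ m) (hp : p ≠ 2) (hd : d * Fintype.card G = p ^ n - 1)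
    (hχ : Function.Injective fun g => χ g ^ d) :
    letI := topAction (coord_torusPoint e) (extMap_torusAction e χ) d
    IsGenericExtension.{u, v} (ZMod p) G (baseRing e (indet (ZMod p) n))
      (topRing e (indet (ZMod p) n) d) := by
  let _ := topAction (coord_torusPoint e) (extMap_torusAction e χ) d
  have hn : n ≠ 0 := by
    rintro rfl
    exact e.index_nonempty.elim fun i => i.elim0
  exact
    { galois := isGaloisRingExtension_topRing (coord_torusPoint e) (extMap_torusAction e χ) hn hd hχ
      localizedPolynomial := isLocalizedPolynomialRing_baseRing e
      generic := fun L _ _ M _ _ _ hM =>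
        exists_specializesTo e χ hm hG hp hd hχ L M hM }

/-- The number `d = (p ^ n - 1) / 2 ^ m` is odd, so `d`-th powers of a faithful character of a
`2`-group remain faithful. -/
lemma exists_character_pow_injective (e : Module.Basis (Fin n) (ZMod p) F) {m d : ℕ}
    (hd : d * 2 ^ m = p ^ n - 1)
    (h' : ¬ 2 ^ (m + 1) ∣ p ^ n - 1) :
    ∃ χ : Multiplicative (ZMod (2 ^ m)) →* Fˣ, Function.Injective χ ∧
      Function.Injective fun g => χ g ^ d := by
  have : Module.Finite (ZMod p) F := Module.Finite.of_basis e
  have : Finite F := Module.finite_of_finite (ZMod p)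
  have hcard : Nat.card Fˣ = p ^ n - 1 := by
    rw [Nat.card_units, natCard_eq_of_basis e]
  obtain ⟨χ, hχ⟩ := exists_injective_character (F := F) (N := 2 ^ m)
    (hcard ▸ hd ▸ Dvd.intro_left d rfl)
  refine ⟨χ, hχ, fun g h hgh => ?_⟩
  have hcop : Nat.Coprime (Nat.card (Multiplicative (ZMod (2 ^ m)))) d := by
    have h1 : Nat.card (Multiplicative (ZMod (2 ^ m))) = 2 ^ m := Nat.card_zmod (2 ^ m)
    rw [h1]
    refine Nat.Coprime.pow_left _ (Nat.coprime_two_left.2 ?_)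
    rw [← Nat.not_even_iff_odd, even_iff_two_dvd]
    intro h2
    apply h'
    rw [pow_succ, ← hd, mul_comm]
    exact mul_dvd_mul h2 dvd_rfl
  refine (powCoprime hcop).injective (hχ ?_)
  change χ (g ^ d) = χ (h ^ d)
  rw [map_pow, map_pow]
  exact hgh

end Main


theorem mainTheorem5 (p : ℕ) [Fact p.Prime] (hp : p ≠ 2) (m n : ℕ)
    (h : 2 ^ m ∣ p ^ n - 1) (h' : ¬ 2 ^ (m + 1) ∣ p ^ n - 1) :
    (∃ (R S : Type) (_ : CommRing R) (_ : CommRing S) (_ : Algebra (ZMod p) R) (_ : Algebra R S)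
        (_ : MulSemiringAction (Multiplicative (ZMod (2 ^ m))) S),
        IsGenericExtension.{u, v} (ZMod p) (Multiplicative (ZMod (2 ^ m))) R S) ∧
    ∀ (F : Type w) [Field F] [Algebra (ZMod p) F] (e : Module.Basis (Fin n) (ZMod p) F)
      (d : ℕ) (U : Matrix (Fin n) (Fin n) (RatFuncs (ZMod p) n)),
      d = (p ^ n - 1) / 2 ^ m →
      -- `U` is the general element of the torus
      U = resMatrix e (indet (ZMod p) n) →
      ∃ (ι : Multiplicative (ZMod (2 ^ m)) →* GL (Fin n) (ZMod p))
        (_ : MulSemiringAction (Multiplicative (ZMod (2 ^ m))) (topRing e (indet (ZMod p) n) d)),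
        Function.Injective ι ∧
        (∀ g, ι g ∈ resTorus e (ZMod p)) ∧
        -- `g` acts by `U ↦ U * ι g`, hence sends the entries of `U ^ d` to those of `(U * ι g) ^ d`
        (∀ (g : Multiplicative (ZMod (2 ^ m))) (i j : Fin n)
            (s : topRing e (indet (ZMod p) n) d),
          (s : RatFuncs (ZMod p) n) = (U ^ d) i j →
          (MulSemiringAction.toRingHom (Multiplicative (ZMod (2 ^ m)))
              (topRing e (indet (ZMod p) n) d) g s : RatFuncs (ZMod p) n) =
            ((U * (ι g : Matrix (Fin n) (Fin n) (ZMod p)).map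
                (algebraMap (ZMod p) (RatFuncs (ZMod p) n))) ^ d) i j) ∧
        IsGenericExtension.{u, v} (ZMod p) (Multiplicative (ZMod (2 ^ m)))
          (baseRing e (indet (ZMod p) n)) (topRing e (indet (ZMod p) n) d) := by
  have hp' : p.Prime := Fact.out
  have hn : n ≠ 0 := by
    rintro rfl
    simp at h'
  have hm : m ≠ 0 := by
    rintro rfl
    have h1 : Even (p ^ n - 1) := Nat.Odd.sub_odd (hp'.odd_of_ne_two hp).pow odd_one
    exact h' (by simpa using h1.two_dvd)
  have hG : Fintype.card (Multiplicative (ZMod (2 ^ m))) = 2 ^ m := by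
    rw [Fintype.card_multiplicative, ZMod.card]
  have hd : (p ^ n - 1) / 2 ^ m * 2 ^ m = p ^ n - 1 := Nat.div_mul_cancel h
  have hd' : (p ^ n - 1) / 2 ^ m * Fintype.card (Multiplicative (ZMod (2 ^ m))) = p ^ n - 1 := by
    rw [hG, hd]
  constructor
  · have e : Module.Basis (Fin n) (ZMod p) (GaloisField p n) :=
      Module.finBasisOfFinrankEq _ _ (GaloisField.finrank p hn)
    obtain ⟨χ, -, hχ⟩ := exists_character_pow_injective e hd h'
    exact ⟨_, _, _, _, _, _, _, isGenericExtension_topRing e χ hm hG hp hd' hχ⟩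
  · rintro F _ _ e d U rfl rfl
    obtain ⟨χ, hχ, hχd⟩ := exists_character_pow_injective e hd h'
    refine ⟨torusEmbedding e χ, topAction (coord_torusPoint e) (extMap_torusAction e χ) _,
      torusEmbedding_injective e χ hχ, torusEmbedding_mem e χ, ?_,
      isGenericExtension_topRing e χ hm hG hp hd' hχd⟩
    intro g i j s hs
    rw [← torusAction_pow_apply, ← hs]
    rfl
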